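/- All graphs are finite and simple. A graph is $t$-connected if it has more than $t$ vertices and deleting any set of fewer than $t$ vertices leaves a connected graph. For a tree $R$, let $\mathrm{Leaf}(R)$ be its set of vertices of degree $1$, and for $x\in V(R)\setminus\mathrm{Leaf}(R)$ let $d'(x)$ be the degree of $x$ in $R-\mathrm{Leaf}(R)$ and $\ell(x)$ the number of leaves of $R$ adjacent to $x$. For an integer $k\ge 2$, let $\mathcal{T}(2k+1)$ be the set of all trees $T_R$ obtained as follows. Let $R$ be a tree such that $d'(x)\in\{1,3,\dots,2k+1\}$ and $2\ell(x)+d'(x)\le 2k+1$ for every $x\in V(R)\setminus\mathrm{Leaf}(R)$. Then $T_R$ is obtained from $R$ by inserting a new vertex of degree $2$ into each edge of $R-\mathrm{Leaf}(R)$ and by adding, for each vertex $x$ of $R-\mathrm{Leaf}(R)$ with $d'(x)=2r+1<2k+1$, $k-r-\ell(x)$ new pendant edges at $x$. A $\{K_{1,1},\dots,K_{1,k},\mathcal{T}(2k+1)\}$-factor of a graph $G$ is a spanning subgraph of $G$ each of whose connected components is isomorphic to one of $K_{1,1},\dots,K_{1,k}$ or to a member of $\mathcal{T}(2k+1)$.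 **Theorem.** Let $k$, $t$, $n$ be integers with $k\ge 2$, $1\le t\le k-1$ and $$n\ \ge\ \frac{(2k^2+5k+1)t+k^2+5k+2}{2k}.$$ (i) If $G$ is a $t$-connected graph of order $n$ with $$|E(G)|>\binom{n-\lfloor (k+\frac12)t\rfloor-1}{2}+t\left(\lfloor (k+\tfrac12)t\rfloor+1\right),$$ then $G$ has a $\{K_{1,1},\dots,K_{1,k},\mathcal{T}(2k+1)\}$-factor. (ii) The bound in (i) is sharp: the graph $$K_t\vee\left(K_{n-\lfloor (k+\frac32)t\rfloor-1}\cup\left(\lfloor (k+\tfrac12)t\rfloor+1\right)K_1\right),$$ where $\vee$ denotes the join and $\cup$ the disjoint union, has order $n$, is $t$-connected, has exactly $\binom{n-\lfloor (k+\frac12)t\rfloor-1}{2}+t\left(\lfloor (k+\frac12)t\rfloor+1\right)$ edges, and has no $\{K_{1,1},\dots,K_{1,k},\mathcal{T}(2k+1)\}$-factor. -/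

import Mathlib

namespace ComponentFactor

open SimpleGraph

universe u v

/-- `G` is `t`-connected: it has more than `t` vertices, and deleting fewer than `t` vertices
always leaves a connected graph. -/
def IsTConnected {V : Type u} [Fintype V] (G : SimpleGraph V) (t : ℕ) : Prop :=
  t < Fintype.card V ∧
    ∀ S : Finset V, S.card < t → (G.induce ((S : Set V)ᶜ)).Connected

/-- The set of leaves (vertices of degree one) of `R`. -/
def leafSet {V : Type u} (R : SimpleGraph V) : Set V :=
  {x | (R.neighborSet x).ncard = 1}

/-- The type of the vertices of `R` that are not leaves. -/
abbrev CoreVert {V : Type u} (R : SimpleGraph V) : Type u :=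
  ((leafSet R)ᶜ : Set V)

/-- The graph `R - Leaf(R)`. -/
abbrev core {V : Type u} (R : SimpleGraph V) : SimpleGraph (CoreVert R) :=
  R.induce (leafSet R)ᶜ

/-- The degree of `x` in `R - Leaf(R)`. -/
noncomputable def coreDegree {V : Type u} (R : SimpleGraph V) (x : CoreVert R) : ℕ :=
  ((core R).neighborSet x).ncard

/-- The number of leaves of `R` adjacent to `x`. -/
noncomputable def leafCount {V : Type u} (R : SimpleGraph V) (x : CoreVert R) : ℕ :=
  (R.neighborSet x ∩ leafSet R).ncard

/-- `R` is a tree such that every vertex `x` that is not a leaf has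
`d_{R - Leaf(R)}(x) ∈ {1, 3, …, 2k+1}` and
`2 (number of leaves adjacent to x) + d_{R - Leaf(R)}(x) ≤ 2k+1`. -/
def IsBaseTree (k : ℕ) {V : Type u} (R : SimpleGraph V) : Prop :=
  R.IsTree ∧
    ∀ x : CoreVert R,
      (Odd (coreDegree R x) ∧ coreDegree R x ≤ 2 * k + 1) ∧
        2 * leafCount R x + coreDegree R x ≤ 2 * k + 1

/-- The vertices of `T_R`: the vertices of `R`, one new vertex for each edge of `R - Leaf(R)`,
and, for each vertex `x` of `R - Leaf(R)` with `d_{R - Leaf(R)}(x) = 2r+1`, another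
`k - r - (number of leaves adjacent to x)` new vertices. For a base tree the subtraction is exact,
and it gives `0` if `r = k`. -/
inductive TreeVert (k : ℕ) {V : Type u} (R : SimpleGraph V) : Type u
  | old (x : V) : TreeVert k R
  | mid (e : (core R).edgeSet) : TreeVert k R
  | pendant (x : CoreVert R) (i : Fin (k - coreDegree R x / 2 - leafCount R x)) : TreeVert k R

/-- The edges of `T_R`, each listed in at least one direction. -/
def treeRel (k : ℕ) {V : Type u} (R : SimpleGraph V) : TreeVert k R → TreeVert k R → Prop
  | .old x, .old y => R.Adj x y ∧ (x ∈ leafSet R ∨ y ∈ leafSet R)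
  | .old x, .mid e => ∃ y : CoreVert R, (y : V) = x ∧ y ∈ (e : Sym2 (CoreVert R))
  | .old x, .pendant y _ => (y : V) = x
  | _, _ => False

/-- The tree `T_R`: every edge of `R - Leaf(R)` is subdivided once, the edges of `R` at leaves
are kept, and the new pendant edges are attached. -/
def treeOf (k : ℕ) {V : Type u} (R : SimpleGraph V) : SimpleGraph (TreeVert k R) :=
  SimpleGraph.fromRel (treeRel k R)

/-- `F` is isomorphic to one of `K_{1,1}, …, K_{1,k}` or to a member `T_R` of `𝒯(2k+1)`. -/
def IsAllowedComponent (k : ℕ) (W : Type u) (F : SimpleGraph W) : Prop :=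
  (∃ j : ℕ, 1 ≤ j ∧ j ≤ k ∧ Nonempty (F ≃g completeBipartiteGraph (Fin 1) (Fin j))) ∨
    ∃ (m : ℕ) (R : SimpleGraph (Fin m)), IsBaseTree k R ∧ Nonempty (F ≃g treeOf k R)

/-- `G` has a spanning subgraph `H` each of whose connected components belongs to `𝓗`. -/
def HasComponentFactor {V : Type u} (G : SimpleGraph V)
    (𝓗 : (W : Type u) → SimpleGraph W → Prop) : Prop :=
  ∃ H : SimpleGraph V, H ≤ G ∧ ∀ c : H.ConnectedComponent, 𝓗 c c.toSimpleGraph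

/-- `G` has a `{K_{1,1}, …, K_{1,k}, 𝒯(2k+1)}`-factor. -/
def HasStarTreeFactor (k : ℕ) {V : Type u} (G : SimpleGraph V) : Prop :=
  HasComponentFactor G (IsAllowedComponent k)

/-- The join of two vertex-disjoint graphs. -/
def join {V : Type u} {W : Type v} (G : SimpleGraph V) (H : SimpleGraph W) :
    SimpleGraph (V ⊕ W) :=
  (G ⊕g H) ⊔ completeBipartiteGraph V W

/-- `⌊(k + 1/2) t⌋`. -/
def halfFloor (k t : ℕ) : ℕ := ⌊((k : ℚ) + 1 / 2) * t⌋₊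

/-- `C(n - ⌊(k + 1/2) t⌋ - 1, 2) + t (⌊(k + 1/2) t⌋ + 1)`. -/
def edgeBound (k t n : ℕ) : ℕ :=
  (n - halfFloor k t - 1).choose 2 + t * (halfFloor k t + 1)

/-- `K_t ∨ (K_{n - ⌊(k + 3/2) t⌋ - 1} ∪ (⌊(k + 1/2) t⌋ + 1) K_1)`. -/
def extremalGraph (k t n : ℕ) :
    SimpleGraph (Fin t ⊕ (Fin (n - ⌊((k : ℚ) + 3 / 2) * t⌋₊ - 1) ⊕ Fin (halfFloor k t + 1))) :=
  join ⊤ (⊤ ⊕g ⊥)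

end ComponentFactor

namespace ComponentFactor

open SimpleGraph

universe u v

/-! ### Edge weightings with bounded vertex loads, and parity exchanges -/

section Weighting

variable {V : Type u}

/-! Everything passes through a criterion, `IsoBound`: a set of vertices whose neighbours all lie in
a disjoint set `S` has size at most `(k + 1/2)|S|`. For finite graphs and the `k` in question it is
equivalent to having the factor (`IsoBound.hasStarTreeFactor`, `HasStarTreeFactor.isoBound`).

From the criterion to a factor. Doubling the criterion to all vertex sets gives Hall's condition,
hence an integer matrix on the edges with row and column sums in `[2, 2k+1]`. Adding its transpose
gives a symmetric weighting with loads in `[4, 4k+2]`. Choose such a weighting with fewest odd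
edges: an odd edge must join a vertex of least load to one of greatest load, and alternating `±1`
along a cycle of odd edges would remove them, so the odd edges form a forest. A leaf of that forest
would have odd load, but both extreme loads are even. So all weights are even and can be halved
(`IsoBound.exists_weighting`). Among weightings with loads in `[2, 2k+1]`, minimise the number of
odd edges and then the total weight. Now odd edges have weight one and form a forest joining loads
`2` and `2k+1`, while the other edges have weight two and a pendant end
(`IsWeighting.exists_isReduced`). A component of the support is a star if it has no vertex of load
`2k+1`; otherwise those vertices are the core of some `T_R`, and vertices on two odd edges are its
subdivision vertices.

From a factor to the criterion. Each allowed component carries a weighting with loads in `[2,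
2k+1]`, and counting the weight between the two sets gives the bound.

For (i), suppose `S` violates the criterion. Connectivity forces `|S| ≥ t`, and then the number of
edges is at most a function of `|S|` whose value at `t` is largest (`edge_bound_monotone`). For
(ii), the `t` vertices of `K_t` in the extremal graph violate the criterion. -/

/-- The number of edges of odd weight. -/
noncomputable def oddCount (y : Sym2 V → ℤ) : ℕ := {e | Odd (y e)}.ncard

theorem oddCount_lt [Finite V] {y y' : Sym2 V → ℤ} (h : ∀ e, Odd (y' e) → Odd (y e)) {e : Sym2 V}
    (he : Odd (y e)) (he' : ¬ Odd (y' e)) : oddCount y' < oddCount y :=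
  Set.ncard_lt_ncard ⟨fun e h' => h e h', fun hs => he' (hs he)⟩ (Set.toFinite _)

open Classical in
/-- Weights `1, -1, 1, …` along the edges of a walk. -/
noncomputable def altWeight {G : SimpleGraph V} : {u v : V} → G.Walk u v → Sym2 V → ℤ
  | _, _, .nil => fun _ => 0
  | _, _, .cons (u := u) (v := x) _ p => fun e => (if e = s(u, x) then 1 else 0) - altWeight p e

theorem altWeight_eq_zero {G : SimpleGraph V} {u v : V} (p : G.Walk u v) {e : Sym2 V}
    (he : e ∉ p.edges) : altWeight p e = 0 := by
  induction p with
  | nil => rfl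
  | cons h p ih =>
    simp only [Walk.edges_cons, List.mem_cons, not_or] at he
    simp [altWeight, he.1, ih he.2]

theorem altWeight_eq_or {G : SimpleGraph V} {u v : V} (p : G.Walk u v) (hp : p.IsTrail)
    {e : Sym2 V} (he : e ∈ p.edges) : altWeight p e = 1 ∨ altWeight p e = -1 := by
  induction p with
  | nil => simp at he
  | cons h p ih =>
    rw [Walk.isTrail_cons] at hp
    simp only [Walk.edges_cons, List.mem_cons] at he
    simp only [altWeight]
    split_ifs with h1
    · subst h1
      simp [altWeight_eq_zero p hp.2]
    · rcases ih hp.1 (he.resolve_left h1) with h2 | h2 <;> simp [h2]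

variable [Fintype V]

/-- The total weight of the edges at `v`. -/
def load (y : Sym2 V → ℤ) (v : V) : ℤ := ∑ w, y s(v, w)

/-- `y` is a nonnegative integral weighting of the edges of `G` all of whose vertex loads
lie in `[a, b]`. -/
structure IsWeighting (G : SimpleGraph V) (a b : ℤ) (y : Sym2 V → ℤ) : Prop where
  nonneg : ∀ e, 0 ≤ y e
  supp : ∀ e, e ∉ G.edgeSet → y e = 0
  lower : ∀ v, a ≤ load y v
  upper : ∀ v, load y v ≤ b

theorem load_add (y z : Sym2 V → ℤ) (v : V) :
    load (fun e => y e + z e) v = load y v + load z v := by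
  simp [load, Finset.sum_add_distrib]

theorem load_sub (y z : Sym2 V → ℤ) (v : V) :
    load (fun e => y e - z e) v = load y v - load z v := by
  simp [load, Finset.sum_sub_distrib]

open Classical in
theorem load_single {p q : V} (hpq : p ≠ q) (c : ℤ) (v : V) :
    load (fun e => if e = s(p, q) then c else 0) v =
      (if v = p then c else 0) + (if v = q then c else 0) := by
  unfold load
  by_cases hp : v = p
  · subst hp
    have : ∀ w, (s(v, w) = s(v, q)) ↔ w = q := by intro w; rw [Sym2.eq_iff]; grind
    simp [this, hpq]
  · by_cases hq : v = q
    · subst hq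
      have : ∀ w, (s(v, w) = s(p, v)) ↔ w = p := by
        intro w; rw [Sym2.eq_iff]; grind
      simp [this, hp]
    · have : ∀ w, ¬ (s(v, w) = s(p, q)) := by
        intro w; simp [hp, hq]
      simp [this, hp, hq]

open Classical in
theorem load_altWeight {G : SimpleGraph V} {u v : V} (p : G.Walk u v) (z : V) :
    load (altWeight p) z =
      (if z = u then 1 else 0) - (-1) ^ p.length * (if z = v then 1 else 0) := by
  induction p with
  | nil => simp [altWeight, load]
  | cons h p ih =>
    simp only [altWeight, load_sub, load_single h.ne, ih, Walk.length_cons]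
    ring

variable {G : SimpleGraph V} {a b : ℤ} {y : Sym2 V → ℤ}

open Classical in
theorem IsWeighting.add_single (hy : IsWeighting G a b y) {p q : V} (hpq : G.Adj p q) {c : ℤ}
    (h0 : 0 ≤ y s(p, q) + c) (hp : a ≤ load y p + c ∧ load y p + c ≤ b)
    (hq : a ≤ load y q + c ∧ load y q + c ≤ b) :
    IsWeighting G a b (fun e => y e + if e = s(p, q) then c else 0) := by
  have hl := fun v => load_add y (fun e => if e = s(p, q) then c else 0) v
  simp only [load_single hpq.ne] at hl
  refine ⟨fun e => ?_, fun e he => ?_, fun v => ?_, fun v => ?_⟩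
  · split_ifs with h
    · rw [h]; exact h0
    · simpa using hy.nonneg e
  · have : e ≠ s(p, q) := by rintro rfl; exact he hpq
    simp [this, hy.supp e he]
  · rw [hl]
    have := hpq.ne
    by_cases h1 : v = p
    · subst h1; simp [this, hp.1]
    · by_cases h2 : v = q
      · subst h2; simp [h1, hq.1]
      · simp [h1, h2, hy.lower]
  · rw [hl]
    have := hpq.ne
    by_cases h1 : v = p
    · subst h1; simp [this, hp.2]
    · by_cases h2 : v = q
      · subst h2; simp [h1, hq.2]
      · simp [h1, h2, hy.upper]

theorem IsWeighting.adj_of_odd (hy : IsWeighting G a b y) {p q : V} (h : Odd (y s(p, q))) :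
    G.Adj p q := by
  by_contra hn
  rw [hy.supp s(p, q) hn] at h
  simp at h

/-- Changing an odd edge by `1` or by `-1` would make it even, so minimality makes both changes
infeasible. The increase can only be blocked by an end of load `b` and the decrease by an end of
load `a`; these ends differ because `a < b`. -/
theorem IsWeighting.odd_edge_loads (hy : IsWeighting G a b y) (hab : a < b)
    (hmin : ∀ y', IsWeighting G a b y' → oddCount y ≤ oddCount y') {p q : V}
    (h : Odd (y s(p, q))) :
    (load y p = a ∧ load y q = b) ∨ (load y p = b ∧ load y q = a) := by
  classical
  have hadj := hy.adj_of_odd h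
  have key : ∀ c : ℤ, Odd c → ¬ (0 ≤ y s(p, q) + c ∧ (a ≤ load y p + c ∧ load y p + c ≤ b) ∧
      (a ≤ load y q + c ∧ load y q + c ≤ b)) := by
    rintro c hc ⟨h0, h1, h2⟩
    refine absurd (hmin _ (hy.add_single hadj h0 h1 h2)) (not_le.2 (oddCount_lt ?_ h ?_))
    · intro e he
      split_ifs at he with h3
      · rwa [h3]
      · simpa using he
    · simpa using h.add_odd hc
  have h1 := key 1 (by decide)
  have h2 := key (-1) (by decide)
  have hpos : 1 ≤ y s(p, q) := by
    have := hy.nonneg s(p, q)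
    rcases h with ⟨r, hr⟩
    omega
  have := hy.lower p
  have := hy.lower q
  have := hy.upper p
  have := hy.upper q
  omega

theorem IsWeighting.even_length (hy : IsWeighting G a b y) (hab : a < b)
    (hmin : ∀ y', IsWeighting G a b y' → oddCount y ≤ oddCount y') {H : SimpleGraph V} {p q : V}
    (c : H.Walk p q) (hodd : ∀ e ∈ c.edges, Odd (y e)) :
    Even c.length ↔ (load y p = a ↔ load y q = a) := by
  induction c with
  | nil => simp
  | cons h c ih =>
    have h1 := hy.odd_edge_loads hab hmin (hodd _ (List.mem_cons_self ..))
    rw [Walk.length_cons, Nat.even_add_one, ih (fun e he => hodd e (by simp [he]))]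
    grind

/-- Loads alternate between `a` and `b` along odd edges, so such a cycle would have even length.
Adding `1, -1, 1, …` around it then keeps every load and makes all its edges even, against
minimality. -/
theorem IsWeighting.not_isCycle_of_odd (hy : IsWeighting G a b y) (hab : a < b)
    (hmin : ∀ y', IsWeighting G a b y' → oddCount y ≤ oddCount y') {H : SimpleGraph V} {p : V}
    (c : H.Walk p p) (hodd : ∀ e ∈ c.edges, Odd (y e)) : ¬ c.IsCycle := by
  classical
  intro hc
  have heven := (hy.even_length hab hmin c hodd).2 Iff.rfl
  have hl : ∀ v, load (fun e => y e + altWeight c e) v = load y v := by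
    intro v
    rw [load_add, load_altWeight, heven.neg_one_pow]
    simp
  have hoff : ∀ e, e ∉ c.edges → y e + altWeight c e = y e := by
    intro e he; simp [altWeight_eq_zero c he]
  have hon : ∀ e, e ∈ c.edges → Even (y e + altWeight c e) ∧ 0 ≤ y e + altWeight c e := by
    intro e he
    obtain ⟨r, hr⟩ := hodd e he
    have := hy.nonneg e
    rcases altWeight_eq_or c hc.isTrail he with h | h <;> rw [h]
    · exact ⟨⟨r + 1, by omega⟩, by omega⟩
    · exact ⟨⟨r, by omega⟩, by omega⟩
  have hw : IsWeighting G a b (fun e => y e + altWeight c e) := by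
    refine ⟨fun e => ?_, fun e he => ?_, fun v => ?_, fun v => ?_⟩
    · by_cases h : e ∈ c.edges
      · exact (hon e h).2
      · rw [hoff e h]; exact hy.nonneg e
    · have : e ∉ c.edges := by
        intro h
        have := hodd e h
        rw [hy.supp e he] at this
        simp at this
      rw [hoff e this]
      exact hy.supp e he
    · rw [hl]; exact hy.lower v
    · rw [hl]; exact hy.upper v
  obtain ⟨e, he⟩ : ∃ e, e ∈ c.edges := by
    cases c with
    | nil => simp at hc
    | cons h c => exact ⟨_, List.mem_cons_self ..⟩
  refine absurd (hmin _ hw) (not_le.2 (oddCount_lt ?_ (hodd e he) ?_))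
  · intro e' he'
    by_cases h : e' ∈ c.edges
    · exact hodd e' h
    · rwa [hoff e' h] at he'
  · exact Int.not_odd_iff_even.2 (hon e he).1

end Weighting

/-! ### From the isolated-vertex criterion to a weighting with loads in `[2, 2k+1]` -/

section Existence

variable {V : Type u}

/-- Every set of vertices all of whose neighbours lie in a disjoint set `S` has at most
`(k + 1/2) |S|` elements. -/
def IsoBound (k : ℕ) (G : SimpleGraph V) : Prop :=
  ∀ S B : Finset V, Disjoint B S → (∀ v ∈ B, ∀ w, G.Adj v w → w ∈ S) →
    2 * B.card ≤ (2 * k + 1) * S.card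

theorem IsAcyclic.exists_unique_adj [Finite V] {O : SimpleGraph V} (hO : O.IsAcyclic) {p q : V}
    (hpq : O.Adj p q) : ∃ v w, O.Adj v w ∧ ∀ w', O.Adj v w' → w' = w := by
  classical
  have := Fintype.ofFinite V
  let c := O.connectedComponentMk p
  have hp : p ∈ c.supp := rfl
  have hq : q ∈ c.supp := ConnectedComponent.sound hpq.symm.reachable
  have hnt : Nontrivial c := ⟨⟨⟨p, hp⟩, ⟨q, hq⟩, fun h => hpq.ne (congrArg Subtype.val h)⟩⟩
  obtain ⟨v, hv⟩ := (hO.isTree_connectedComponent c).exists_vert_degree_one_of_nontrivial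
  rw [degree_eq_one_iff_existsUnique_adj] at hv
  obtain ⟨w, hw, huniq⟩ := hv
  refine ⟨v, w, hw, fun w' hw' => ?_⟩
  have hw'c : w' ∈ c.supp := by
    have h1 : O.connectedComponentMk v.1 = c := v.2
    have h2 : O.connectedComponentMk w' = O.connectedComponentMk v.1 :=
      ConnectedComponent.sound hw'.symm.reachable
    exact h2.trans h1
  exact congrArg Subtype.val (huniq ⟨w', hw'c⟩ hw')

variable {G : SimpleGraph V}

/-- This is Hall's condition for the map that follows. The part common to `A` and its neighbourhood
`N` costs nothing, since `2 ≤ 2k + 1`; the criterion applies to what remains. -/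
theorem IsoBound.card_le_card_neighbors {k : ℕ} (hk : 1 ≤ k) (hG : IsoBound k G) (A N : Finset V)
    (hN : ∀ w, w ∈ N ↔ ∃ v ∈ A, G.Adj v w) : 2 * A.card ≤ (2 * k + 1) * N.card := by
  classical
  have h1 := hG (N \ A) (A \ N) (by
    rw [Finset.disjoint_left]; intro x; simp; tauto) (by
    intro v hv w hw
    simp only [Finset.mem_sdiff] at hv ⊢
    refine ⟨(hN w).2 ⟨v, hv.1, hw⟩, fun hwA => hv.2 ((hN v).2 ⟨w, hwA, hw.symm⟩)⟩)
  have h2 := Finset.card_sdiff_add_card_inter A N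
  have h3 := Finset.card_sdiff_add_card_inter N A
  rw [Finset.inter_comm] at h3
  rw [← h2, ← h3]
  nlinarith [Nat.zero_le (A ∩ N).card]

variable [Fintype V]

theorem IsoBound.exists_injective {k : ℕ} (hk : 1 ≤ k) (hG : IsoBound k G) :
    ∃ f : V × Fin 2 → V × Fin (2 * k + 1), Function.Injective f ∧ ∀ x, G.Adj x.1 (f x).1 := by
  classical
  let t : V × Fin 2 → Finset (V × Fin (2 * k + 1)) :=
    fun x => (Finset.univ.filter (fun w => G.Adj x.1 w)) ×ˢ Finset.univ
  obtain ⟨f, hf, hft⟩ := (Finset.all_card_le_biUnion_card_iff_exists_injective t).1 (by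
    intro X
    let A := X.image Prod.fst
    let N := Finset.univ.filter (fun w => ∃ v ∈ A, G.Adj v w)
    have h1 : X.biUnion t = N ×ˢ Finset.univ := by
      ext ⟨w, j⟩
      simp [t, N, A]
    have h2 : X ⊆ A ×ˢ Finset.univ := by
      intro x hx
      simp only [Finset.mem_product, Finset.mem_univ, and_true]
      exact Finset.mem_image_of_mem _ hx
    have h3 := hG.card_le_card_neighbors hk A N (by simp [N])
    have h4 := Finset.card_le_card h2
    rw [h1]
    simp only [Finset.card_product, Finset.card_univ, Fintype.card_fin] at h4 ⊢
    linarith)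
  refine ⟨f, hf, fun x => ?_⟩
  have := hft x
  simp only [t, Finset.mem_product, Finset.mem_filter, Finset.mem_univ, true_and, and_true] at this
  exact this

/-- The Hall injection saturates two copies of each vertex on one side only. A Schröder–Bernstein
argument with the injection used in both directions saturates copies `0` and `1` on both sides at
once, while each vertex still has only `2k + 1` copies available for edges. -/
theorem IsoBound.exists_bijective {k : ℕ} (hk : 1 ≤ k) (hG : IsoBound k G) :
    ∃ h : V × ℕ ≃ V × ℕ, ∀ x, (G.Adj x.1 (h x).1 ∧ x.2 < 2 * k + 1 ∧ (h x).2 < 2 * k + 1) ∨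
      (2 ≤ x.2 ∧ 2 ≤ (h x).2) := by
  classical
  obtain ⟨f, hf, hadj⟩ := hG.exists_injective hk
  -- Copies with label at least `2` are shifted beyond the range of labels used by `f`, which keeps
  -- the map injective. They need not follow an edge, as recorded by the second alternative in `R`.
  let g : V × ℕ → V × ℕ := fun x =>
    if hx : x.2 < 2 then ((f (x.1, ⟨x.2, hx⟩)).1, (f (x.1, ⟨x.2, hx⟩)).2)
    else (x.1, x.2 + 2 * k + 1)
  have hg : Function.Injective g := by
    rintro ⟨v, i⟩ ⟨w, j⟩ hvw
    simp only [g] at hvw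
    split_ifs at hvw with h1 h2 h2
    · have h3 : f (v, ⟨i, h1⟩) = f (w, ⟨j, h2⟩) := by
        simp only [Prod.mk.injEq] at hvw
        exact Prod.ext hvw.1 (Fin.ext hvw.2)
      simpa using hf h3
    · simp only [Prod.mk.injEq] at hvw
      have := (f (v, ⟨i, h1⟩)).2.2
      omega
    · simp only [Prod.mk.injEq] at hvw
      have := (f (w, ⟨j, h2⟩)).2.2
      omega
    · simp only [Prod.mk.injEq] at hvw
      exact Prod.ext hvw.1 (by simp only; omega)
  let R : V × ℕ → V × ℕ → Prop := fun x z =>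
    (G.Adj x.1 z.1 ∧ x.2 < 2 * k + 1 ∧ z.2 < 2 * k + 1) ∨ (2 ≤ x.2 ∧ 2 ≤ z.2)
  have hR : ∀ x, R x (g x) := by
    intro x
    simp only [R, g]
    split_ifs with hx
    · left
      exact ⟨hadj (x.1, ⟨x.2, hx⟩), by omega, (f (x.1, ⟨x.2, hx⟩)).2.2⟩
    · right
      simp only
      omega
  have hRs : ∀ x z, R x z → R z x := by
    rintro x z (⟨h1, h2, h3⟩ | ⟨h1, h2⟩)
    · exact Or.inl ⟨h1.symm, h3, h2⟩
    · exact Or.inr ⟨h2, h1⟩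
  obtain ⟨h, hbij, hh⟩ := Function.Embedding.schroeder_bernstein_of_rel hg hg R hR
    (fun x => hRs _ _ (hR x))
  exact ⟨Equiv.ofBijective h hbij, hh⟩

theorem card_filter_sum_bounds [DecidableEq V] {b : ℕ} (hb : 2 ≤ b) (p : ℕ → V) (P : ℕ → Prop)
    [DecidablePred P]
    (h : ∀ i < 2, P i) :
    2 ≤ ∑ v, ((Finset.range b).filter (fun i => p i = v ∧ P i)).card ∧
      ∑ v, ((Finset.range b).filter (fun i => p i = v ∧ P i)).card ≤ b := by
  have h1 : ∑ v, ((Finset.range b).filter (fun i => p i = v ∧ P i)).card =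
      ((Finset.range b).filter P).card := by
    rw [Finset.card_eq_sum_card_fiberwise (f := p) (t := Finset.univ) (by simp)]
    refine Finset.sum_congr rfl fun v _ => ?_
    rw [Finset.filter_filter]
    simp only [and_comm]
  rw [h1]
  constructor
  · have : Finset.range 2 ⊆ (Finset.range b).filter P := by
      intro i hi
      simp only [Finset.mem_range, Finset.mem_filter] at hi ⊢
      exact ⟨by omega, h i hi⟩
    simpa using Finset.card_le_card this
  · simpa using Finset.card_filter_le (Finset.range b) P

theorem IsoBound.exists_double_weighting {k : ℕ} (hk : 1 ≤ k) (hG : IsoBound k G) :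
    ∃ z, IsWeighting G 4 (4 * k + 2) z := by
  classical
  obtain ⟨h, hh⟩ := hG.exists_bijective hk
  let Y : V → V → ℕ := fun u v => ((Finset.range (2 * k + 1)).filter (fun i =>
    (h (u, i)).1 = v ∧ (G.Adj u (h (u, i)).1 ∧ (h (u, i)).2 < 2 * k + 1))).card
  -- The entry is recounted from the side of `v`, so that column sums obey the same bounds as row
  -- sums.
  have hY : ∀ u v, Y u v = ((Finset.range (2 * k + 1)).filter (fun j =>
      (h.symm (v, j)).1 = u ∧ (G.Adj (h.symm (v, j)).1 v ∧
        (h.symm (v, j)).2 < 2 * k + 1))).card := by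
    intro u v
    refine Finset.card_nbij' (fun i => (h (u, i)).2) (fun j => (h.symm (v, j)).2) ?_ ?_ ?_ ?_
    · intro i hi
      simp only [Finset.coe_filter, Finset.mem_range, Set.mem_ofPred_eq] at hi ⊢
      obtain ⟨h1, h2, h3, h4⟩ := hi
      have : h.symm (v, (h (u, i)).2) = (u, i) := by
        rw [Equiv.symm_apply_eq, ← h2]
      rw [this, ← h2]
      exact ⟨h4, rfl, h3, h1⟩
    · intro j hj
      simp only [Finset.coe_filter, Finset.mem_range, Set.mem_ofPred_eq] at hj ⊢
      obtain ⟨h1, h2, h3, h4⟩ := hj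
      have : h (u, (h.symm (v, j)).2) = (v, j) := by
        rw [← Equiv.eq_symm_apply, ← h2]
      rw [this, ← h2]
      exact ⟨h4, rfl, h3, h1⟩
    · intro i hi
      simp only [Finset.coe_filter, Finset.mem_range, Set.mem_ofPred_eq] at hi
      have : h.symm (v, (h (u, i)).2) = (u, i) := by
        rw [Equiv.symm_apply_eq, ← hi.2.1]
      simp [this]
    · intro j hj
      simp only [Finset.coe_filter, Finset.mem_range, Set.mem_ofPred_eq] at hj
      have : h (u, (h.symm (v, j)).2) = (v, j) := by
        rw [← Equiv.eq_symm_apply, ← hj.2.1]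
      simp [this]
  have hYadj : ∀ u v, ¬ G.Adj u v → Y u v = 0 := by
    intro u v huv
    simp only [Y, Finset.card_eq_zero, Finset.filter_eq_empty_iff]
    rintro i - ⟨rfl, h2, -⟩
    exact huv h2
  have hrow : ∀ u, 2 ≤ ∑ v, Y u v ∧ ∑ v, Y u v ≤ 2 * k + 1 := by
    intro u
    refine card_filter_sum_bounds (b := 2 * k + 1) (by omega) (fun i => (h (u, i)).1)
      (fun i => G.Adj u (h (u, i)).1 ∧ (h (u, i)).2 < 2 * k + 1) fun i hi => ?_
    rcases hh (u, i) with h1 | h1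
    · exact ⟨h1.1, h1.2.2⟩
    · exact absurd h1.1 (by simpa using hi)
  have hcol : ∀ v, 2 ≤ ∑ u, Y u v ∧ ∑ u, Y u v ≤ 2 * k + 1 := by
    intro v
    simp only [hY]
    refine card_filter_sum_bounds (b := 2 * k + 1) (by omega) (fun j => (h.symm (v, j)).1)
      (fun j => G.Adj (h.symm (v, j)).1 v ∧ (h.symm (v, j)).2 < 2 * k + 1) fun j hj => ?_
    have := hh (h.symm (v, j))
    rw [Equiv.apply_symm_apply] at this
    rcases this with h1 | h1
    · exact ⟨h1.1, h1.2.1⟩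
    · exact absurd h1.2 (by simpa using hj)
  let z : Sym2 V → ℤ := Sym2.lift ⟨fun u v => (Y u v : ℤ) + Y v u, fun u v => add_comm _ _⟩
  have hz : ∀ u v, z s(u, v) = (Y u v : ℤ) + Y v u := fun u v => rfl
  have hload : ∀ v, load z v = ((∑ w, Y v w : ℕ) : ℤ) + ((∑ w, Y w v : ℕ) : ℤ) := by
    intro v
    simp only [load, hz, Finset.sum_add_distrib]
    push_cast
    rfl
  refine ⟨z, fun e => ?_, fun e he => ?_, fun v => ?_, fun v => ?_⟩
  · induction e with | _ u v => rw [hz]; positivity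
  · induction e with | _ u v =>
      rw [hz, hYadj u v he, hYadj v u (fun h => he h.symm)]; simp
  · rw [hload]
    have := (hrow v).1
    have := (hcol v).1
    omega
  · rw [hload]
    have := (hrow v).2
    have := (hcol v).2
    omega

theorem load_odd_of_unique {y : Sym2 V → ℤ} {v w : V} (h : Odd (y s(v, w)))
    (huniq : ∀ w', Odd (y s(v, w')) → w' = w) : Odd (load y v) := by
  classical
  unfold load
  rw [← Finset.add_sum_erase _ _ (Finset.mem_univ w)]
  refine h.add_even (Finset.even_sum _ fun w' hw' => ?_)
  rw [← Int.not_odd_iff_even]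
  exact fun h' => (Finset.ne_of_mem_erase hw') (huniq w' h')

/-- The doubled bounds `4` and `4k + 2` are both even, whereas an end vertex of the odd forest has
odd load. Hence a minimal doubled weighting has no odd edge and can be halved. -/
theorem IsoBound.exists_weighting {k : ℕ} (hk : 1 ≤ k) (hG : IsoBound k G) :
    ∃ y, IsWeighting G 2 (2 * k + 1) y := by
  obtain ⟨z, hz, hmin⟩ := WellFounded.has_min (measure (oddCount (V := V))).wf
    {z | IsWeighting G 4 (4 * k + 2) z} (hG.exists_double_weighting hk)
  replace hz : IsWeighting G 4 (4 * k + 2) z := hz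
  replace hmin : ∀ y', IsWeighting G 4 (4 * k + 2) y' → oddCount z ≤ oddCount y' :=
    fun y' hy' => not_lt.1 (hmin y' hy')
  have hab : (4 : ℤ) < 4 * k + 2 := by omega
  have hno : ∀ p q, ¬ Odd (z s(p, q)) := by
    intro p q hpq
    let O : SimpleGraph V := SimpleGraph.mk (fun u v => Odd (z s(u, v)))
      ⟨fun u v h => by rwa [Sym2.eq_swap]⟩ ⟨fun u h => (hz.adj_of_odd h).ne rfl⟩
    have hO : O.IsAcyclic := by
      intro v c hc
      refine hz.not_isCycle_of_odd hab hmin c (fun e he => ?_) hc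
      have := c.edges_subset_edgeSet he
      induction e with | _ u v => exact this
    obtain ⟨v, w, hvw, huniq⟩ := IsAcyclic.exists_unique_adj hO (p := p) (q := q) hpq
    have h1 := load_odd_of_unique hvw huniq
    rcases hz.odd_edge_loads hab hmin hvw with h2 | h2
    · rw [h2.1] at h1
      exact absurd h1 (by decide)
    · rw [h2.1] at h1
      obtain ⟨r, hr⟩ := h1
      omega
  have heven : ∀ e, z e = 2 * (z e / 2) := by
    intro e
    induction e with | _ p q =>
      have := hno p q
      rw [Int.not_odd_iff_even] at this
      obtain ⟨r, hr⟩ := this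
      omega
  have hload : ∀ v, load z v = 2 * load (fun e => z e / 2) v := by
    intro v
    simp only [load, Finset.mul_sum]
    exact Finset.sum_congr rfl fun w _ => heven _
  refine ⟨fun e => z e / 2, fun e => ?_, fun e he => ?_, fun v => ?_, fun v => ?_⟩
  · have := hz.nonneg e
    omega
  · simp [hz.supp e he]
  · have := hz.lower v
    rw [hload] at this
    omega
  · have := hz.upper v
    rw [hload] at this
    omega

end Existence

/-! ### Recognising members of `𝒯(2k+1)` by suppressing subdivision vertices -/

section TreeRecognition

/-- `F` is a tree whose vertices are split into core vertices `C`, leaves `L` attached to core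
vertices, and vertices `M` of degree two that join two core vertices, where a core vertex with `d`
neighbours in `M` has odd `d` and `k + 1/2 - d/2` neighbours in `L`. -/
structure IsSubdividedTree {Z : Type u} (k : ℕ) (F : SimpleGraph Z) (C L M : Set Z) : Prop where
  conn : F.Connected
  acyclic : F.IsAcyclic
  cover : ∀ v, v ∈ C ∨ v ∈ L ∨ v ∈ M
  core_not_leaf : ∀ v ∈ C, v ∉ L
  core_not_mid : ∀ v ∈ C, v ∉ M
  leaf_not_mid : ∀ v ∈ L, v ∉ M
  core_indep : ∀ x ∈ C, ∀ y ∈ C, ¬ F.Adj x y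
  leaf : ∀ v ∈ L, ∃ x ∈ C, ∀ w, F.Adj v w ↔ w = x
  mid : ∀ v ∈ M, ∃ x ∈ C, ∃ x' ∈ C, x ≠ x' ∧ ∀ w, F.Adj v w ↔ w = x ∨ w = x'
  odd : ∀ x ∈ C, Odd {m | m ∈ M ∧ F.Adj x m}.ncard
  deg : ∀ x ∈ C, 2 * {l | l ∈ L ∧ F.Adj x l}.ncard + {m | m ∈ M ∧ F.Adj x m}.ncard = 2 * k + 1

variable {Z : Type u} {U : Type v} {k : ℕ} {F : SimpleGraph Z} {C L M : Set Z}

/-- The graph on `U` obtained from `F` by suppressing the vertices of `M`. -/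
def suppress (F : SimpleGraph Z) (M : Set Z) (φ : U → Z) : SimpleGraph U where
  Adj a b := a ≠ b ∧ (F.Adj (φ a) (φ b) ∨ ∃ m ∈ M, F.Adj (φ a) m ∧ F.Adj m (φ b))
  symm := ⟨by
    rintro a b ⟨h1, h2 | ⟨m, hm, h2, h3⟩⟩
    · exact ⟨h1.symm, Or.inl h2.symm⟩
    · exact ⟨h1.symm, Or.inr ⟨m, hm, h3.symm, h2.symm⟩⟩⟩
  loopless := ⟨fun a h => h.1 rfl⟩

theorem eq_of_common_neighbors {F : SimpleGraph Z} (hF : F.IsAcyclic) {x x' m m' : Z} (hx : x ≠ x')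
    (h1 : F.Adj x m) (h2 : F.Adj m x') (h3 : F.Adj x m') (h4 : F.Adj m' x') : m = m' := by
  let p : F.Path x x' := ⟨.cons h1 (.cons h2 .nil), by simp [h1.ne, h2.ne, hx]⟩
  let q : F.Path x x' := ⟨.cons h3 (.cons h4 .nil), by simp [h3.ne, h4.ne, hx]⟩
  have h := congrArg (fun p : F.Path x x' => p.1.support) ((hF.subsingleton_path x x').elim p q)
  simpa [p, q] using h

theorem Reachable.map_of_adj {R : SimpleGraph U} {F : SimpleGraph Z} {φ : U → Z}
    (h : ∀ a b, R.Adj a b → F.Reachable (φ a) (φ b)) {a b : U} (hab : R.Reachable a b) :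
    F.Reachable (φ a) (φ b) := by
  obtain ⟨p⟩ := hab
  induction p with
  | nil => exact Reachable.refl _
  | cons h' _ ih => exact (h _ _ h').trans ih

namespace IsSubdividedTree

variable {φ : U → Z}

theorem mid_adj_mem_core (hF : IsSubdividedTree k F C L M) {m w : Z} (hm : m ∈ M)
    (h : F.Adj m w) : w ∈ C := by
  obtain ⟨x, hx, x', hx', -, hiff⟩ := hF.mid m hm
  rcases (hiff w).1 h with rfl | rfl <;> assumption

theorem mid_unique (hF : IsSubdividedTree k F C L M) {m x x' w : Z} (hm : m ∈ M)
    (hne : x ≠ x') (h : F.Adj m x) (h' : F.Adj m x')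
    (hw : F.Adj m w) : w = x ∨ w = x' := by
  obtain ⟨y, hy, y', hy', -, hiff⟩ := hF.mid m hm
  have h1 := (hiff x).1 h
  have h2 := (hiff x').1 h'
  have h3 := (hiff w).1 hw
  grind

theorem suppress_adj_leaf_iff (hF : IsSubdividedTree k F C L M) {a b : U} (hb : φ b ∈ L) :
    (suppress F M φ).Adj a b ↔ F.Adj (φ a) (φ b) := by
  constructor
  · rintro ⟨-, h | ⟨m, hm, -, h⟩⟩
    · exact h
    · exact absurd hb (hF.core_not_leaf _ (hF.mid_adj_mem_core hm h))
  · exact fun h => ⟨fun e => h.ne (congrArg φ e), Or.inl h⟩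

theorem suppress_adj_core_iff (hF : IsSubdividedTree k F C L M) {a b : U} (ha : φ a ∈ C)
    (hb : φ b ∈ C) :
    (suppress F M φ).Adj a b ↔ a ≠ b ∧ ∃ m ∈ M, F.Adj (φ a) m ∧ F.Adj m (φ b) :=
  and_congr_right fun _ => or_iff_right (hF.core_indep _ ha _ hb)

/-- Every edge is a bridge: a walk avoiding it expands to a walk of `F` that avoids the
corresponding edge, or the first half of the corresponding subdivided edge, and `F` is acyclic. -/
theorem suppress_isAcyclic (hF : IsSubdividedTree k F C L M)
    (hφ : Function.Injective φ) (hrange : ∀ v, v ∉ M ↔ ∃ a, φ a = v)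
    : (suppress F M φ).IsAcyclic := by
  have hnot : ∀ a, φ a ∉ M := fun a => (hrange _).2 ⟨a, rfl⟩
  rw [isAcyclic_iff_forall_adj_isBridge]
  rintro a b ⟨hab, h | ⟨m, hm, h1, h2⟩⟩
  · have hb := isAcyclic_iff_forall_adj_isBridge.1 hF.acyclic h
    rw [isBridge_iff] at hb ⊢
    refine fun hr => hb (Reachable.map_of_adj ?_ hr)
    intro a' b' h'
    rw [deleteEdges_adj, Set.mem_singleton_iff] at h'
    obtain ⟨⟨hne, h' | ⟨m, hm, h3, h4⟩⟩, hn⟩ := h'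
    · refine Adj.reachable ((deleteEdges_adj).2 ⟨h', fun he => hn ?_⟩)
      rw [Set.mem_singleton_iff, Sym2.eq_iff] at he
      rw [Sym2.eq_iff]
      rcases he with he | he
      · exact Or.inl ⟨hφ he.1, hφ he.2⟩
      · exact Or.inr ⟨hφ he.1, hφ he.2⟩
    · have hma : ∀ c, m ≠ φ c := fun c hc => hnot c (hc ▸ hm)
      refine (Adj.reachable ((deleteEdges_adj).2 ⟨h3, fun he => ?_⟩)).trans
        (Adj.reachable ((deleteEdges_adj).2 ⟨h4, fun he => ?_⟩))
      · rw [Set.mem_singleton_iff, Sym2.eq_iff] at he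
        rcases he with he | he
        · exact hma _ he.2
        · exact hma _ he.2
      · rw [Set.mem_singleton_iff, Sym2.eq_iff] at he
        rcases he with he | he
        · exact hma _ he.1
        · exact hma _ he.1
  · have hb := isAcyclic_iff_forall_adj_isBridge.1 hF.acyclic h1
    have hma : ∀ c, φ c ≠ m := fun c hc => hnot c (hc ▸ hm)
    rw [isBridge_iff] at hb ⊢
    refine fun hr => hb ((Reachable.map_of_adj (φ := φ) ?_ hr).trans
      (Adj.reachable ((deleteEdges_adj).2 ⟨h2.symm, fun he => ?_⟩)))
    · intro a' b' h'
      rw [deleteEdges_adj, Set.mem_singleton_iff] at h'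
      obtain ⟨⟨hne, h' | ⟨m', hm', h3, h4⟩⟩, hn⟩ := h'
      · refine Adj.reachable ((deleteEdges_adj).2 ⟨h', fun he => ?_⟩)
        rw [Set.mem_singleton_iff, Sym2.eq_iff] at he
        rcases he with he | he
        · exact hma _ he.2
        · exact hma _ he.1
      · have hmm : m' ≠ m := by
          rintro rfl
          apply hn
          rw [Sym2.eq_iff]
          have e1 := hF.mid_unique hm' (fun e => hab (hφ e)) h1.symm h2 h3.symm
          have e2 := hF.mid_unique hm' (fun e => hab (hφ e)) h1.symm h2 h4
          rcases e1 with e1 | e1 <;> rcases e2 with e2 | e2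
          · exact absurd (hφ (e1.trans e2.symm)) hne
          · exact Or.inl ⟨hφ e1, hφ e2⟩
          · exact Or.inr ⟨hφ e1, hφ e2⟩
          · exact absurd (hφ (e1.trans e2.symm)) hne
        refine (Adj.reachable ((deleteEdges_adj).2 ⟨h3, fun he => ?_⟩)).trans
          (Adj.reachable ((deleteEdges_adj).2 ⟨h4, fun he => ?_⟩))
        · rw [Set.mem_singleton_iff, Sym2.eq_iff] at he
          rcases he with he | he
          · exact hmm he.2
          · exact hma _ he.1
        · rw [Set.mem_singleton_iff, Sym2.eq_iff] at he
          rcases he with he | he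
          · exact hma _ he.2
          · exact hmm he.1
    · rw [Set.mem_singleton_iff, Sym2.eq_iff] at he
      rcases he with he | he
      · exact hab (hφ he.1.symm)
      · exact hma _ he.1

theorem suppress_connected (hF : IsSubdividedTree k F C L M)
    (hφ : Function.Injective φ) (hrange : ∀ v, v ∉ M ↔ ∃ a, φ a = v)
    : (suppress F M φ).Connected := by
  have hnot : ∀ a, φ a ∉ M := fun a => (hrange _).2 ⟨a, rfl⟩
  -- A vertex outside `M` is represented by itself, a vertex of `M` by either neighbour;
  -- representatives of adjacent vertices are joined in the suppressed graph.
  let Q : Z → U → Prop := fun v a => (v ∉ M ∧ φ a = v) ∨ (v ∈ M ∧ F.Adj v (φ a))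
  have hQ : ∀ v, ∃ a, Q v a := by
    intro v
    by_cases hv : v ∈ M
    · obtain ⟨x, hx, x', hx', -, hiff⟩ := hF.mid v hv
      obtain ⟨a, ha⟩ := (hrange x).1 (hF.core_not_mid x hx)
      exact ⟨a, Or.inr ⟨hv, by rw [ha]; exact (hiff x).2 (Or.inl rfl)⟩⟩
    · obtain ⟨a, ha⟩ := (hrange v).1 hv
      exact ⟨a, Or.inl ⟨hv, ha⟩⟩
  have hmid : ∀ m ∈ M, ∀ a b, F.Adj m (φ a) → F.Adj m (φ b) →
      (suppress F M φ).Reachable a b := by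
    intro m hm a b ha hb
    by_cases hab : a = b
    · rw [hab]
    · exact Adj.reachable ⟨hab, Or.inr ⟨m, hm, ha.symm, hb⟩⟩
  have hwalk : ∀ v w (p : F.Walk v w), ∀ a b, Q v a → Q w b →
      (suppress F M φ).Reachable a b := by
    intro v w p
    induction p with
    | nil =>
      rintro a b (⟨h1, rfl⟩ | ⟨h1, h2⟩) (⟨h3, h4⟩ | ⟨h3, h4⟩)
      · rw [hφ h4]
      · exact absurd h3 h1
      · exact absurd h1 h3
      · exact hmid _ h1 _ _ h2 h4
    | @cons v x w h p ih =>
      intro a b ha hb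
      obtain ⟨c, hc⟩ := hQ x
      refine Reachable.trans ?_ (ih c b hc hb)
      rcases ha with ⟨h1, rfl⟩ | ⟨h1, h2⟩ <;> rcases hc with ⟨h3, rfl⟩ | ⟨h3, h4⟩
      · exact Adj.reachable ⟨fun e => h.ne (congrArg φ e), Or.inl h⟩
      · exact hmid _ h3 _ _ h.symm h4
      · exact hmid _ h1 _ _ h2 h
      · exact absurd h3 (hF.core_not_mid _ (hF.mid_adj_mem_core h1 h))
  obtain ⟨v⟩ := hF.conn.nonempty
  obtain ⟨a, -⟩ := hQ v
  have : Nonempty U := ⟨a⟩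
  refine ⟨fun a b => ?_⟩
  obtain ⟨p⟩ := hF.conn.preconnected (φ a) (φ b)
  exact hwalk _ _ p a b (Or.inl ⟨hnot a, rfl⟩) (Or.inl ⟨hnot b, rfl⟩)

theorem suppress_neighborSet_leaf (hF : IsSubdividedTree k F C L M)
    (hφ : Function.Injective φ) (hrange : ∀ v, v ∉ M ↔ ∃ a, φ a = v)
    {a : U} (ha : φ a ∈ L) :
    ((suppress F M φ).neighborSet a).ncard = 1 := by
  obtain ⟨x, hx, hiff⟩ := hF.leaf _ ha
  obtain ⟨b, rfl⟩ := (hrange x).1 (hF.core_not_mid x hx)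
  rw [Set.ncard_eq_one]
  refine ⟨b, ?_⟩
  ext c
  simp only [mem_neighborSet, Set.mem_singleton_iff]
  constructor
  · rintro ⟨-, h | ⟨m, hm, h, -⟩⟩
    · exact hφ ((hiff _).1 h)
    · rw [hiff] at h
      exact absurd hm (h ▸ hF.core_not_mid _ hx)
  · rintro rfl
    have := (hiff _).2 rfl
    exact ⟨fun e => this.ne (congrArg φ e), Or.inl this⟩

theorem image_leaf_neighbors (hF : IsSubdividedTree k F C L M)
    (hrange : ∀ v, v ∉ M ↔ ∃ a, φ a = v) (a : U) :
    φ '' {b | (suppress F M φ).Adj a b ∧ φ b ∈ L} = {l | l ∈ L ∧ F.Adj (φ a) l} := by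
  ext v
  simp only [Set.mem_image, Set.mem_ofPred_eq]
  constructor
  · rintro ⟨b, ⟨h1, h2⟩, rfl⟩
    exact ⟨h2, (hF.suppress_adj_leaf_iff h2).1 h1⟩
  · rintro ⟨h1, h2⟩
    obtain ⟨b, rfl⟩ := (hrange v).1 (hF.leaf_not_mid v h1)
    exact ⟨b, ⟨(hF.suppress_adj_leaf_iff h1).2 h2, h1⟩, rfl⟩

theorem ncard_core_neighbors (hF : IsSubdividedTree k F C L M)
    (hφ : Function.Injective φ) (hrange : ∀ v, v ∉ M ↔ ∃ a, φ a = v)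
    {a : U} (ha : φ a ∈ C) :
    {b | (suppress F M φ).Adj a b ∧ φ b ∈ C}.ncard = {m | m ∈ M ∧ F.Adj (φ a) m}.ncard := by
  have hex : ∀ b, (suppress F M φ).Adj a b ∧ φ b ∈ C → ∃ m ∈ M, F.Adj (φ a) m ∧ F.Adj m (φ b) :=
    fun b hb => ((hF.suppress_adj_core_iff ha hb.2).1 hb.1).2
  choose f hf using hex
  refine Set.ncard_congr f (fun b hb => ⟨(hf b hb).1, (hf b hb).2.1⟩) ?_ ?_
  · intro b c hb hc hbc
    have h1 := hf b hb
    have h2 := hf c hc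
    rw [← hbc] at h2
    have h3 := hF.mid_unique h1.1 (fun e => hb.1.1 (hφ e)) h1.2.1.symm h1.2.2 h2.2.2
    rcases h3 with h3 | h3
    · exact absurd (hφ h3).symm hc.1.1
    · exact (hφ h3).symm
  · rintro m ⟨hm, hadj⟩
    obtain ⟨x, hx, x', hx', hne, hiff⟩ := hF.mid m hm
    obtain ⟨y, hy, hya, hym⟩ : ∃ y ∈ C, y ≠ φ a ∧ F.Adj m y := by
      rcases (hiff _).1 hadj.symm with h | h
      · exact ⟨x', hx', by rw [h]; exact hne.symm, (hiff _).2 (Or.inr rfl)⟩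
      · exact ⟨x, hx, by rw [h]; exact hne, (hiff _).2 (Or.inl rfl)⟩
    obtain ⟨b, rfl⟩ := (hrange y).1 (hF.core_not_mid y hy)
    have hb : (suppress F M φ).Adj a b ∧ φ b ∈ C :=
      ⟨⟨fun e => hya (congrArg φ e.symm), Or.inr ⟨m, hm, hadj, hym⟩⟩, hy⟩
    refine ⟨b, hb, ?_⟩
    have h1 := hf b hb
    exact eq_of_common_neighbors hF.acyclic hya.symm h1.2.1 h1.2.2 hadj hym

theorem mem_leafSet_iff (hF : IsSubdividedTree k F C L M)
    (hφ : Function.Injective φ) (hrange : ∀ v, v ∉ M ↔ ∃ a, φ a = v)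
    [Finite U] (hk : 1 ≤ k) {a : U} :
    a ∈ leafSet (suppress F M φ) ↔ φ a ∈ L := by
  refine ⟨fun h => ?_, hF.suppress_neighborSet_leaf hφ hrange⟩
  by_contra hL
  have hC : φ a ∈ C := by
    rcases hF.cover (φ a) with h | h | h
    · exact h
    · exact absurd h hL
    · exact absurd h ((hrange _).2 ⟨a, rfl⟩)
  have h1 : (suppress F M φ).neighborSet a = {b | (suppress F M φ).Adj a b ∧ φ b ∈ L} ∪
      {b | (suppress F M φ).Adj a b ∧ φ b ∈ C} := by
    ext b
    have h2 := hF.cover (φ b)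
    have h3 : φ b ∉ M := (hrange _).2 ⟨b, rfl⟩
    simp only [mem_neighborSet, Set.mem_union, Set.mem_ofPred_eq]
    tauto
  have h2 : ((suppress F M φ).neighborSet a).ncard = 1 := h
  rw [h1, Set.ncard_union_eq, ← Set.ncard_image_of_injective _ hφ,
    hF.image_leaf_neighbors hrange, hF.ncard_core_neighbors hφ hrange hC] at h2
  -- If a core vertex had degree one, its odd number of neighbours in `M` would be one and it would
  -- have none in `L`, forcing `2k + 1 = 1`.
  · have h3 := hF.deg _ hC
    obtain ⟨r, hr⟩ := hF.odd _ hC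
    omega
  · rw [Set.disjoint_left]
    exact fun b hb hb' => hF.core_not_leaf _ hb'.2 hb.2

theorem core_mem_iff (hF : IsSubdividedTree k F C L M)
    (hφ : Function.Injective φ) (hrange : ∀ v, v ∉ M ↔ ∃ a, φ a = v)
    [Finite U] (hk : 1 ≤ k) {a : U} :
    a ∉ leafSet (suppress F M φ) ↔ φ a ∈ C := by
  rw [hF.mem_leafSet_iff hφ hrange hk]
  have h1 := hF.cover (φ a)
  have h2 : φ a ∉ M := (hrange _).2 ⟨a, rfl⟩
  have h3 := hF.core_not_leaf (φ a)
  tauto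

theorem leafCount_suppress (hF : IsSubdividedTree k F C L M)
    (hφ : Function.Injective φ) (hrange : ∀ v, v ∉ M ↔ ∃ a, φ a = v)
    [Finite U] (hk : 1 ≤ k) (x : CoreVert (suppress F M φ)) :
    leafCount (suppress F M φ) x = {l | l ∈ L ∧ F.Adj (φ x) l}.ncard := by
  rw [← hF.image_leaf_neighbors hrange, Set.ncard_image_of_injective _ hφ]
  unfold leafCount
  congr 1
  ext b
  simp [hF.mem_leafSet_iff hφ hrange hk]

theorem coreDegree_suppress (hF : IsSubdividedTree k F C L M)
    (hφ : Function.Injective φ) (hrange : ∀ v, v ∉ M ↔ ∃ a, φ a = v)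
    [Finite U] (hk : 1 ≤ k) (x : CoreVert (suppress F M φ)) :
    coreDegree (suppress F M φ) x = {m | m ∈ M ∧ F.Adj (φ x) m}.ncard := by
  rw [← hF.ncard_core_neighbors hφ hrange ((hF.core_mem_iff hφ hrange hk).1 x.2),
    coreDegree, ← Set.ncard_image_of_injective _ Subtype.val_injective]
  congr 1
  ext b
  simp only [Set.mem_image, mem_neighborSet, Set.mem_ofPred_eq]
  constructor
  · rintro ⟨y, hy, rfl⟩
    exact ⟨hy, (hF.core_mem_iff hφ hrange hk).1 y.2⟩
  · rintro ⟨h1, h2⟩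
    exact ⟨⟨b, (hF.core_mem_iff hφ hrange hk).2 h2⟩, h1, rfl⟩

theorem suppress_isBaseTree (hF : IsSubdividedTree k F C L M)
    (hφ : Function.Injective φ) (hrange : ∀ v, v ∉ M ↔ ∃ a, φ a = v)
    [Finite U] (hk : 1 ≤ k) : IsBaseTree k (suppress F M φ) := by
  refine ⟨⟨hF.suppress_connected hφ hrange, hF.suppress_isAcyclic hφ hrange⟩, fun x => ?_⟩
  have hx := (hF.core_mem_iff hφ hrange hk).1 x.2
  rw [hF.coreDegree_suppress hφ hrange hk, hF.leafCount_suppress hφ hrange hk]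
  have := hF.deg _ hx
  exact ⟨⟨hF.odd _ hx, by omega⟩, by omega⟩

theorem exists_mid_of_edge (hF : IsSubdividedTree k F C L M)
    (hφ : Function.Injective φ) (hrange : ∀ v, v ∉ M ↔ ∃ a, φ a = v)
    [Finite U] (hk : 1 ≤ k) (e : (core (suppress F M φ)).edgeSet) :
    ∃ m ∈ M, ∀ y : CoreVert (suppress F M φ), F.Adj (φ y) m ↔ y ∈ (e : Sym2 _) := by
  obtain ⟨e, he⟩ := e
  induction e with | _ x y =>
    have hx := (hF.core_mem_iff hφ hrange hk).1 x.2
    have hy := (hF.core_mem_iff hφ hrange hk).1 y.2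
    have hadj : (suppress F M φ).Adj x y := he
    obtain ⟨hne, m, hm, h1, h2⟩ := (hF.suppress_adj_core_iff hx hy).1 hadj
    refine ⟨m, hm, fun z => ?_⟩
    rw [Sym2.mem_iff]
    constructor
    · intro hz
      rcases hF.mid_unique hm (fun e => hne (hφ e)) h1.symm h2 hz.symm with h | h
      · exact Or.inl (Subtype.ext (hφ h))
      · exact Or.inr (Subtype.ext (hφ h))
    · rintro (rfl | rfl)
      · exact h1
      · exact h2.symm

theorem nonempty_iso_treeOf (hF : IsSubdividedTree k F C L M)
    (hφ : Function.Injective φ) (hrange : ∀ v, v ∉ M ↔ ∃ a, φ a = v)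
    [Finite U] (hk : 1 ≤ k) :
    Nonempty (F ≃g treeOf k (suppress F M φ)) := by
  choose μ hμM hμ using hF.exists_mid_of_edge hφ hrange hk
  have hnot : ∀ a, φ a ∉ M := fun a => (hrange _).2 ⟨a, rfl⟩
  -- All of `L` is kept as leaves of the base tree, so `deg` leaves no room for further pendant
  -- edges.
  have hpend : ∀ x : CoreVert (suppress F M φ),
      Fin (k - coreDegree (suppress F M φ) x / 2 - leafCount (suppress F M φ) x) → False := by
    intro x i
    have hi := i.pos
    have hx := (hF.core_mem_iff hφ hrange hk).1 x.2
    rw [hF.coreDegree_suppress hφ hrange hk, hF.leafCount_suppress hφ hrange hk] at hi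
    have := hF.deg _ hx
    omega
  let ψ : TreeVert k (suppress F M φ) → Z := fun t => match t with
    | .old a => φ a
    | .mid e => μ e
    | .pendant x i => φ x
  have hinj : Function.Injective ψ := by
    rintro (a | e | ⟨x, i⟩) (b | e' | ⟨x', i'⟩) h
    · rw [hφ h]
    · exact absurd (hμM e') (by rw [← show φ a = μ e' from h]; exact hnot a)
    · exact (hpend x' i').elim
    · exact absurd (hμM e) (by rw [show μ e = φ b from h]; exact hnot b)
    · have h' : μ e = μ e' := h
      have : e = e' := by
        refine Subtype.ext (Sym2.ext fun y => ?_)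
        rw [← hμ e y, ← hμ e' y, h']
      rw [this]
    · exact (hpend x' i').elim
    · exact (hpend x i).elim
    · exact (hpend x i).elim
    · exact (hpend x i).elim
  have hsurj : Function.Surjective ψ := by
    intro v
    by_cases hv : v ∈ M
    · obtain ⟨x, hx, x', hx', hne, hiff⟩ := hF.mid v hv
      obtain ⟨a, rfl⟩ := (hrange x).1 (hF.core_not_mid x hx)
      obtain ⟨b, rfl⟩ := (hrange x').1 (hF.core_not_mid x' hx')
      have h1 := (hiff _).2 (Or.inl rfl)
      have h2 := (hiff _).2 (Or.inr rfl)
      let a' : CoreVert (suppress F M φ) := ⟨a, (hF.core_mem_iff hφ hrange hk).2 hx⟩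
      let b' : CoreVert (suppress F M φ) := ⟨b, (hF.core_mem_iff hφ hrange hk).2 hx'⟩
      have hab : (core (suppress F M φ)).Adj a' b' :=
        ⟨fun e => hne (congrArg φ e), Or.inr ⟨v, hv, h1.symm, h2⟩⟩
      refine ⟨.mid ⟨s(a', b'), hab⟩, ?_⟩
      have h3 := (hμ ⟨s(a', b'), hab⟩ a').2 (by simp)
      have h4 := (hμ ⟨s(a', b'), hab⟩ b').2 (by simp)
      exact eq_of_common_neighbors hF.acyclic hne h3 h4.symm h1.symm h2
    · obtain ⟨a, rfl⟩ := (hrange v).1 hv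
      exact ⟨.old a, rfl⟩
  have hadj_old : ∀ a b, F.Adj (φ a) (φ b) ↔ (suppress F M φ).Adj a b ∧
      (a ∈ leafSet (suppress F M φ) ∨ b ∈ leafSet (suppress F M φ)) := by
    intro a b
    rw [hF.mem_leafSet_iff hφ hrange hk, hF.mem_leafSet_iff hφ hrange hk]
    constructor
    · intro h
      refine ⟨⟨fun e => h.ne (congrArg φ e), Or.inl h⟩, ?_⟩
      by_contra hcon
      rw [not_or] at hcon
      have h1 := hF.cover (φ a)
      have h2 := hF.cover (φ b)
      have h3 := hnot a
      have h4 := hnot b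
      have h5 := hF.core_indep (φ a)
      have h6 := h5 (by tauto) (φ b) (by tauto)
      exact h6 h
    · rintro ⟨h, h1 | h1⟩
      · exact ((hF.suppress_adj_leaf_iff h1).1 h.symm).symm
      · exact (hF.suppress_adj_leaf_iff h1).1 h
  have hadj_mid : ∀ a e, F.Adj (φ a) (μ e) ↔
      ∃ y : CoreVert (suppress F M φ), (y : U) = a ∧ y ∈ (e : Sym2 _) := by
    intro a e
    constructor
    · intro h
      have := hF.mid_adj_mem_core (hμM e) h.symm
      exact ⟨⟨a, (hF.core_mem_iff hφ hrange hk).2 this⟩, rfl, (hμ e _).1 h⟩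
    · rintro ⟨y, rfl, hy⟩
      exact (hμ e y).2 hy
  refine ⟨Iso.symm ⟨Equiv.ofBijective ψ ⟨hinj, hsurj⟩, ?_⟩⟩
  intro s t
  rw [treeOf, fromRel_adj]
  rcases s with a | e | ⟨x, i⟩
  · rcases t with b | e' | ⟨x', i'⟩
    · change F.Adj (φ a) (φ b) ↔ _
      rw [hadj_old]
      simp only [treeRel]
      constructor
      · exact fun h => ⟨fun e => h.1.ne (by simpa using e), Or.inl h⟩
      · rintro ⟨-, h | h⟩
        · exact h
        · exact ⟨h.1.symm, h.2.symm⟩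
    · change F.Adj (φ a) (μ e') ↔ _
      rw [hadj_mid]
      simp [treeRel]
    · exact (hpend x' i').elim
  · rcases t with b | e' | ⟨x', i'⟩
    · change F.Adj (μ e) (φ b) ↔ _
      rw [F.adj_comm, hadj_mid]
      simp [treeRel]
    · change F.Adj (μ e) (μ e') ↔ _
      simp only [treeRel, or_self, and_false, iff_false]
      exact fun h => hF.core_not_mid _ (hF.mid_adj_mem_core (hμM e) h) (hμM e')
    · exact (hpend x' i').elim
  · exact (hpend x i).elim

theorem isAllowedComponent (hF : IsSubdividedTree k F C L M) [Finite Z] (hk : 1 ≤ k) :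
    IsAllowedComponent k Z F := by
  right
  obtain ⟨m, ⟨e⟩⟩ := Finite.exists_equiv_fin {v // v ∉ M}
  let φ : Fin m → Z := fun i => (e.symm i : Z)
  have hφ : Function.Injective φ := Subtype.val_injective.comp e.symm.injective
  have hrange : ∀ v, v ∉ M ↔ ∃ a, φ a = v := by
    intro v
    constructor
    · exact fun h => ⟨e ⟨v, h⟩, by simp [φ]⟩
    · rintro ⟨a, rfl⟩
      exact (e.symm a).2
  exact ⟨m, suppress F M φ, hF.suppress_isBaseTree hφ hrange hk,
    hF.nonempty_iso_treeOf hφ hrange hk⟩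

end IsSubdividedTree

end TreeRecognition

/-! ### Reduced weightings and the components of their support -/

section Reduced

theorem isAllowedComponent_of_star {Z : Type u} [Finite Z] {k : ℕ} {F : SimpleGraph Z}
    (hF : F.Connected) (c : Z) (hc : ∀ w, F.Adj c w → ∀ z, F.Adj w z → z = c)
    (h1 : 1 ≤ (F.neighborSet c).ncard) (hk : (F.neighborSet c).ncard ≤ k) :
    IsAllowedComponent k Z F := by
  left
  refine ⟨_, h1, hk, ?_⟩
  have hall : ∀ v, v = c ∨ F.Adj c v := by
    intro v
    obtain ⟨p⟩ := hF.preconnected v c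
    induction p with
    | nil => exact Or.inl rfl
    | cons h p ih =>
      rcases ih hc h1 hk with rfl | h'
      · exact Or.inr h.symm
      · exact Or.inl (hc _ h' _ h.symm)
  let e : F.neighborSet c ≃ Fin (F.neighborSet c).ncard := Finite.equivFin _
  let ψ : Fin 1 ⊕ Fin (F.neighborSet c).ncard → Z := Sum.elim (fun _ => c) (fun i => e.symm i)
  have hadj : ∀ i, F.Adj c (e.symm i) := fun i => (e.symm i).2
  have hbij : Function.Bijective ψ := by
    constructor
    · rintro (i | i) (j | j) h
      · rw [Subsingleton.elim i j]
      · exact absurd (show c = e.symm j from h) (hadj j).ne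
      · exact absurd (show (e.symm i : Z) = c from h) (hadj i).ne'
      · rw [e.symm.injective (Subtype.ext h)]
    · intro v
      rcases hall v with rfl | h
      · exact ⟨.inl 0, rfl⟩
      · exact ⟨.inr (e ⟨v, h⟩), by simp [ψ]⟩
  refine ⟨Iso.symm ⟨Equiv.ofBijective ψ hbij, ?_⟩⟩
  rintro (i | i) (j | j)
  · change F.Adj c c ↔ _
    simp
  · change F.Adj c (e.symm j) ↔ _
    simp [hadj]
  · change F.Adj (e.symm i) c ↔ _
    simp [(hadj i).symm]
  · change F.Adj (e.symm i) (e.symm j) ↔ _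
    simp only [completeBipartiteGraph_adj]
    simp only [Sum.isLeft_inr, Sum.isRight_inr, Bool.false_eq_true, false_and, and_false,
      or_self, iff_false]
    intro h
    exact (hadj j).ne (hc _ (hadj i) _ h).symm

variable {V : Type u} [Fintype V]

/-- A weighting with loads in `[2, 2k+1]` all of whose edges have weight at most two, where the
edges of weight one form a forest joining loads `2` and `2k+1`, and every edge of weight two has
an end that meets no other edge. -/
structure IsReduced (k : ℕ) (G : SimpleGraph V) (y : Sym2 V → ℤ) : Prop where
  weighting : IsWeighting G 2 (2 * k + 1) y
  odd_loads : ∀ p q, Odd (y s(p, q)) →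
    (load y p = 2 ∧ load y q = 2 * k + 1) ∨ (load y p = 2 * k + 1 ∧ load y q = 2)
  not_isCycle : ∀ {H : SimpleGraph V} {p : V} (c : H.Walk p p),
    (∀ e ∈ c.edges, Odd (y e)) → ¬ c.IsCycle
  even_edge : ∀ p q, 0 < y s(p, q) → Even (y s(p, q)) →
    y s(p, q) = 2 ∧ (load y p = 2 ∨ load y q = 2)

variable {G : SimpleGraph V} {y : Sym2 V → ℤ} {k : ℕ}

theorem IsWeighting.sum_le_load {a b : ℤ} (hy : IsWeighting G a b y) (v : V) (s : Finset V) :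
    ∑ w ∈ s, y s(v, w) ≤ load y v :=
  Finset.sum_le_sum_of_subset_of_nonneg (Finset.subset_univ s) fun _ _ _ => hy.nonneg _

theorem IsWeighting.exists_isReduced (hk : 2 ≤ k)
    (hex : ∃ y, IsWeighting G 2 (2 * k + 1) y) : ∃ y, IsReduced k G y := by
  classical
  -- The first coordinate controls the odd edges; the second makes the even ones as light as
  -- possible.
  let f : (Sym2 V → ℤ) → ℕ ×ₗ ℕ := fun y => toLex (oddCount y, (∑ e, y e).toNat)
  obtain ⟨y, hy, hmin⟩ := WellFounded.has_min (InvImage.wf f wellFounded_lt)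
    {y | IsWeighting G 2 (2 * k + 1) y} hex
  replace hy : IsWeighting G 2 (2 * k + 1) y := hy
  have hmin' : ∀ y', IsWeighting G 2 (2 * k + 1) y' →
      ¬ (oddCount y' < oddCount y ∨ oddCount y' = oddCount y ∧ ∑ e, y' e < ∑ e, y e) := by
    intro y' hy' h
    refine hmin y' hy' (Prod.Lex.toLex_lt_toLex.2 ?_)
    rcases h with h | ⟨h1, h2⟩
    · exact Or.inl h
    · have := Finset.sum_nonneg (s := Finset.univ) fun e _ => hy'.nonneg e
      exact Or.inr ⟨h1, by omega⟩
  have hodd : ∀ y', IsWeighting G 2 (2 * k + 1) y' → oddCount y ≤ oddCount y' :=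
    fun y' hy' => not_lt.1 fun h => hmin' y' hy' (Or.inl h)
  have hab : (2 : ℤ) < 2 * k + 1 := by omega
  have hloads := fun p q => hy.odd_edge_loads hab hodd (p := p) (q := q)
  refine ⟨y, hy, hloads, fun c hc => hy.not_isCycle_of_odd hab hodd c hc, ?_⟩
  intro p q hpos heven
  have hadj : G.Adj p q := by
    by_contra hn
    rw [hy.supp s(p, q) hn] at hpos
    exact lt_irrefl _ hpos
  obtain ⟨r, hr⟩ := heven
  -- Otherwise lowering the edge by `2` keeps all parities and decreases the total weight.
  have hlow : ¬ (4 ≤ load y p ∧ 4 ≤ load y q) := by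
    rintro ⟨h1, h2⟩
    have hup := hy.upper p
    have huq := hy.upper q
    refine hmin' _ (hy.add_single hadj (c := -2) (by omega) (by omega) (by omega)) (Or.inr ⟨?_, ?_⟩)
    · unfold oddCount
      congr 1
      ext e
      simp only [Set.mem_ofPred_eq]
      split_ifs with h
      · simp [Int.odd_add, show Even (-2 : ℤ) by decide]
      · simp
    · rw [Finset.sum_add_distrib]
      simp
  have key : ∀ p q, y s(p, q) = r + r → load y p < 4 → y s(p, q) = 2 ∧ load y p = 2 := by
    intro p q hr' hl
    have h1 := hy.sum_le_load p {q}
    rw [Finset.sum_singleton] at h1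
    have h2 : y s(p, q) = 2 := by omega
    refine ⟨h2, ?_⟩
    by_contra h3
    have h4 : load y p = 3 := by have := hy.lower p; omega
    have h5 : Odd (load y p) := by rw [h4]; decide
    -- Load `3` is odd, so some odd edge meets `p`; but ends of odd edges have load `2` or `2k + 1 ≥
    -- 5`. This is where `2 ≤ k` enters.
    have h6 : ∃ w, Odd (y s(p, w)) := by
      by_contra hn
      push Not at hn
      refine (Int.not_odd_iff_even.2 ?_) h5
      exact Finset.even_sum _ fun w _ => Int.not_odd_iff_even.1 (hn w)
    obtain ⟨w, hw⟩ := h6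
    rcases hloads p w hw with h | h <;> omega
  by_cases hp : load y p < 4
  · exact ⟨(key p q hr hp).1, Or.inl (key p q hr hp).2⟩
  · have := key q p (by rw [Sym2.eq_swap]; exact hr) (by omega)
    rw [Sym2.eq_swap] at this
    exact ⟨this.1, Or.inr this.2⟩

/-- The graph of the edges of positive weight. -/
def supportGraph (y : Sym2 V → ℤ) (hy : ∀ v, y s(v, v) = 0) : SimpleGraph V where
  Adj p q := 0 < y s(p, q)
  symm := ⟨fun p q h => by rwa [Sym2.eq_swap]⟩
  loopless := ⟨fun p h => by rw [hy] at h; exact lt_irrefl _ h⟩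

namespace IsReduced

theorem diag (hy : IsReduced k G y) (v : V) : y s(v, v) = 0 :=
  hy.weighting.supp _ (by simp)

/-- The graph of the edges of positive weight. -/
abbrev support (hy : IsReduced k G y) : SimpleGraph V := supportGraph y hy.diag

theorem support_le (hy : IsReduced k G y) : hy.support ≤ G := by
  intro p q h
  by_contra hn
  have h' : 0 < y s(p, q) := h
  rw [hy.weighting.supp s(p, q) hn] at h'
  exact lt_irrefl _ h'

theorem adj_of_odd (hy : IsReduced k G y) {p q : V} (h : Odd (y s(p, q))) :
    hy.support.Adj p q := by
  have := hy.weighting.nonneg s(p, q)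
  obtain ⟨r, hr⟩ := h
  change 0 < y s(p, q)
  omega

theorem adj_iff_of_two (hy : IsReduced k G y) {p q : V} (h : y s(p, q) = 2) (hp : load y p = 2)
    (z : V) : hy.support.Adj p z ↔ z = q := by
  classical
  constructor
  · intro hz
    have hz' : 0 < y s(p, z) := hz
    by_contra hne
    have := hy.weighting.sum_le_load p {z, q}
    rw [Finset.sum_pair hne] at this
    omega
  · rintro rfl
    change 0 < y s(p, z)
    omega

theorem exists_of_odd (hy : IsReduced k G y) {v x : V} (h : Odd (y s(v, x))) (hv : load y v = 2) :
    y s(v, x) = 1 ∧ ∃ x', x ≠ x' ∧ Odd (y s(v, x')) ∧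
      ∀ z, hy.support.Adj v z ↔ z = x ∨ z = x' := by
  classical
  have h1 := hy.weighting.sum_le_load v {x}
  rw [Finset.sum_singleton] at h1
  have hx := hy.weighting.nonneg s(v, x)
  have h2 : y s(v, x) = 1 := by
    obtain ⟨r, hr⟩ := h
    omega
  have h3 : load y v = y s(v, x) + ∑ w ∈ Finset.univ.erase x, y s(v, w) :=
    (Finset.add_sum_erase _ _ (Finset.mem_univ x)).symm
  obtain ⟨x', hx', hne⟩ := Finset.exists_ne_zero_of_sum_ne_zero
    (show ∑ w ∈ Finset.univ.erase x, y s(v, w) ≠ 0 by omega)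
  have hxx' := Finset.ne_of_mem_erase hx'
  have h4 := hy.weighting.sum_le_load v {x, x'}
  rw [Finset.sum_pair hxx'.symm] at h4
  have h5 := hy.weighting.nonneg s(v, x')
  have h6 : y s(v, x') = 1 := by omega
  refine ⟨h2, x', hxx'.symm, by rw [h6]; decide, fun z => ⟨fun hz => ?_, ?_⟩⟩
  · have hz' : 0 < y s(v, z) := hz
    by_contra hn
    rw [not_or] at hn
    have := hy.weighting.sum_le_load v {z, x, x'}
    rw [Finset.sum_insert (by simp [hn.1, hn.2]), Finset.sum_pair hxx'.symm] at this
    omega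
  · rintro (rfl | rfl)
    · change 0 < y s(v, z)
      omega
    · change 0 < y s(v, z)
      omega

/-- An edge of weight two exhausts the load of one of its ends, hence is pendant and a bridge. A
cycle would therefore consist of odd edges only. -/
theorem support_isAcyclic (hy : IsReduced k G y) : hy.support.IsAcyclic := by
  have hbridge : ∀ p q, y s(p, q) = 2 → load y p = 2 → hy.support.IsBridge s(p, q) := by
    intro p q h2 hp
    rw [isBridge_iff]
    rintro ⟨w⟩
    cases w with
    | nil => rw [hy.diag] at h2; omega
    | cons h w =>
      rw [deleteEdges_adj, hy.adj_iff_of_two h2 hp] at h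
      exact h.2 (by rw [h.1]; rfl)
  intro v c hc
  refine hy.not_isCycle c (fun e he => ?_) hc
  by_contra hn
  rw [Int.not_odd_iff_even] at hn
  have hadj := c.edges_subset_edgeSet he
  induction e with | _ p q =>
    have hb : hy.support.IsBridge s(p, q) := by
      obtain ⟨h2, h3 | h3⟩ := hy.even_edge p q hadj hn
      · exact hbridge p q h2 h3
      · rw [Sym2.eq_swap] at h2 ⊢
        exact hbridge q p h2 h3
    exact (isBridge_iff_forall_cycle_notMem hadj).1 hb c hc he

theorem full_even (hy : IsReduced k G y) {x w : V} (hx : load y x = 2 * k + 1)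
    (h : hy.support.Adj x w) (he : Even (y s(x, w))) :
    y s(x, w) = 2 ∧ load y w = 2 ∧ ∀ z, hy.support.Adj w z ↔ z = x := by
  obtain ⟨h1, h2⟩ := hy.even_edge x w h he
  have h3 : load y w = 2 := by omega
  refine ⟨h1, h3, hy.adj_iff_of_two ?_ h3⟩
  rw [Sym2.eq_swap]
  exact h1

theorem full_odd (hy : IsReduced k G y) {x w : V} (hx : load y x = 2 * k + 1)
    (ho : Odd (y s(x, w))) :
    y s(x, w) = 1 ∧ load y w = 2 ∧ ∃ x', x ≠ x' ∧ load y x' = 2 * k + 1 ∧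
      ∀ z, hy.support.Adj w z ↔ z = x ∨ z = x' := by
  have h1 : load y w = 2 := by
    rcases hy.odd_loads x w ho with h | h <;> omega
  rw [Sym2.eq_swap] at ho ⊢
  obtain ⟨h2, x', h3, h4, h5⟩ := hy.exists_of_odd ho h1
  refine ⟨h2, h1, x', h3, ?_, h5⟩
  rcases hy.odd_loads w x' h4 with h | h <;> omega

theorem full_or_adj_full (hy : IsReduced k G y) {x v : V}
    (hx : load y x = 2 * k + 1) (hr : hy.support.Reachable v x) :
    load y v = 2 * k + 1 ∨ ∃ x', load y x' = 2 * k + 1 ∧ hy.support.Adj x' v := by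
  obtain ⟨p⟩ := hr
  induction p with
  | nil => exact Or.inl hx
  | @cons v w x h p ih =>
    rcases ih hx with h' | ⟨x', hx', hadj⟩
    · exact Or.inr ⟨w, h', h.symm⟩
    · left
      rcases Int.even_or_odd (y s(x', w)) with he | ho
      · rw [((hy.full_even hx' hadj he).2.2 v).1 h.symm]
        exact hx'
      · obtain ⟨-, -, x'', -, h3, h4⟩ := hy.full_odd hx' ho
        rcases (h4 v).1 h.symm with rfl | rfl <;> assumption

theorem full_load_eq (hy : IsReduced k G y) {x : V} (hx : load y x = 2 * k + 1) :
    2 * {w | hy.support.Adj x w ∧ Even (y s(x, w))}.ncard + {w | Odd (y s(x, w))}.ncard =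
      2 * k + 1 := by
  classical
  have h : load y x = ∑ w, (2 * (if hy.support.Adj x w ∧ Even (y s(x, w)) then 1 else 0) +
      (if Odd (y s(x, w)) then 1 else 0)) := by
    refine Finset.sum_congr rfl fun w _ => ?_
    rcases Int.even_or_odd (y s(x, w)) with he | ho
    · have hno : ¬ Odd (y s(x, w)) := Int.not_odd_iff_even.2 he
      by_cases hadj : hy.support.Adj x w
      · simp [hadj, (hy.full_even hx hadj he).1]
      · have h1 := hy.weighting.nonneg s(x, w)
        have h2 : ¬ 0 < y s(x, w) := hadj
        have h3 : y s(x, w) = 0 := by omega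
        simp [hadj, h3]
    · have hno : ¬ Even (y s(x, w)) := Int.not_even_iff_odd.2 ho
      simp [(hy.full_odd hx ho).1]
  rw [Finset.sum_add_distrib, ← Finset.mul_sum, Finset.sum_boole, Finset.sum_boole, hx] at h
  rw [Set.ncard_eq_toFinset_card', Set.ncard_eq_toFinset_card', Set.toFinset_ofPred,
    Set.toFinset_ofPred]
  exact_mod_cast h.symm

/-- Vertices of load `2k + 1` form the core. Any other vertex is adjacent to one of these and has
load `2`: it is a leaf on one edge of weight two, or a subdivision vertex on two edges of weight
one. The load `2k + 1` of a core vertex is the degree condition of `IsSubdividedTree`. -/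
theorem isAllowed_of_full (hy : IsReduced k G y) (hk : 2 ≤ k) (c : hy.support.ConnectedComponent)
    {x₀ : V} (hx₀ : x₀ ∈ c.supp) (hfull : load y x₀ = 2 * k + 1) :
    IsAllowedComponent k c c.toSimpleGraph := by
  have hreach : ∀ v : c, load y v = 2 * k + 1 ∨
      ∃ x : c, load y x = 2 * k + 1 ∧ hy.support.Adj x v := by
    intro v
    have h1 : hy.support.Reachable v x₀ := ConnectedComponent.exact (v.2.trans hx₀.symm)
    rcases hy.full_or_adj_full hfull h1 with h | ⟨x, hx, h⟩
    · exact Or.inl h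
    · exact Or.inr ⟨⟨x, (ConnectedComponent.sound h.reachable).trans v.2⟩, hx, h⟩
  have hmem : ∀ (v : c) {w : V}, hy.support.Adj v w → w ∈ c.supp := fun v w h =>
    (ConnectedComponent.sound h.symm.reachable).trans v.2
  have hcore : ∀ x : c, load y x = 2 * k + 1 →
      2 * {l : c | (load y l ≠ 2 * k + 1 ∧ ¬ ∃ w, Odd (y s((l : V), w))) ∧
        c.toSimpleGraph.Adj x l}.ncard +
      {m : c | (load y m ≠ 2 * k + 1 ∧ ∃ w, Odd (y s((m : V), w))) ∧
        c.toSimpleGraph.Adj x m}.ncard = 2 * k + 1 := by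
    intro x hx
    rw [← hy.full_load_eq hx, ← Set.ncard_image_of_injective _ Subtype.val_injective,
      ← Set.ncard_image_of_injective
        {m : c | (load y m ≠ 2 * k + 1 ∧ ∃ w, Odd (y s((m : V), w))) ∧
          c.toSimpleGraph.Adj x m} Subtype.val_injective]
    congr 3
    · ext w
      simp only [Set.mem_image, Set.mem_ofPred_eq]
      constructor
      · rintro ⟨l, ⟨⟨h1, h2⟩, h3⟩, rfl⟩
        refine ⟨h3, Int.not_odd_iff_even.1 fun ho => h2 ⟨x, ?_⟩⟩
        rwa [Sym2.eq_swap]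
      · rintro ⟨h1, h2⟩
        obtain ⟨h3, h4, h5⟩ := hy.full_even hx h1 h2
        refine ⟨⟨w, hmem x h1⟩, ⟨⟨by simp only; omega, ?_⟩, h1⟩, rfl⟩
        rintro ⟨z, hz⟩
        have := (h5 z).1 (hy.adj_of_odd hz)
        subst this
        rw [Sym2.eq_swap] at hz
        exact (Int.not_odd_iff_even.2 h2) hz
    · ext w
      simp only [Set.mem_image, Set.mem_ofPred_eq]
      constructor
      · rintro ⟨m, ⟨⟨h1, z, hz⟩, h3⟩, rfl⟩
        by_contra hn
        rw [Int.not_odd_iff_even] at hn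
        have := ((hy.full_even hx h3 hn).2.2 z).1 (hy.adj_of_odd hz)
        subst this
        rw [Sym2.eq_swap] at hz
        exact (Int.not_odd_iff_even.2 hn) hz
      · intro ho
        refine ⟨⟨w, hmem x (hy.adj_of_odd ho)⟩, ⟨⟨?_, x, ?_⟩, hy.adj_of_odd ho⟩, rfl⟩
        · have := (hy.full_odd hx ho).2.1
          simp only
          omega
        · rwa [Sym2.eq_swap]
  refine IsSubdividedTree.isAllowedComponent (C := {v : c | load y v = 2 * k + 1})
    (L := {v : c | load y v ≠ 2 * k + 1 ∧ ¬ ∃ w, Odd (y s((v : V), w))})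
    (M := {v : c | load y v ≠ 2 * k + 1 ∧ ∃ w, Odd (y s((v : V), w))}) ?_ (by omega)
  refine ⟨c.connected_toSimpleGraph, hy.support_isAcyclic.induce _, fun v => ?_, ?_, ?_, ?_, ?_,
    ?_, ?_, ?_, ?_⟩
  · simp only [Set.mem_ofPred_eq]
    tauto
  · exact fun v h h' => h'.1 h
  · exact fun v h h' => h'.1 h
  · exact fun v h h' => h.2 h'.2
  · intro x hx x' hx' h
    have h' : hy.support.Adj x x' := h
    simp only [Set.mem_ofPred_eq] at hx hx'
    rcases Int.even_or_odd (y s((x : V), x')) with he | ho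
    · have := (hy.full_even hx h' he).2.1
      omega
    · have := (hy.full_odd hx ho).2.1
      omega
  · rintro v ⟨h1, h2⟩
    obtain ⟨x, hx, hadj⟩ := (hreach v).resolve_left h1
    refine ⟨x, hx, fun w => ?_⟩
    have he : Even (y s((x : V), v)) := by
      rw [← Int.not_odd_iff_even]
      refine fun ho => h2 ⟨x, ?_⟩
      rwa [Sym2.eq_swap]
    rw [Subtype.ext_iff, ← (hy.full_even hx hadj he).2.2 w]
    rfl
  · rintro v ⟨h1, z, hz⟩
    obtain ⟨x, hx, hadj⟩ := (hreach v).resolve_left h1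
    have ho : Odd (y s((x : V), v)) := by
      by_contra hn
      rw [Int.not_odd_iff_even] at hn
      have := ((hy.full_even hx hadj hn).2.2 z).1 (hy.adj_of_odd hz)
      subst this
      rw [Sym2.eq_swap] at hz
      exact (Int.not_odd_iff_even.2 hn) hz
    obtain ⟨-, -, x', hne, hx', hiff⟩ := hy.full_odd hx ho
    refine ⟨x, hx, ⟨x', hmem v ((hiff x').2 (Or.inr rfl))⟩, hx', fun e => hne (congrArg _ e),
      fun w => ?_⟩
    rw [Subtype.ext_iff, Subtype.ext_iff, ← hiff w]
    rfl
  · intro x hx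
    have := hcore x hx
    rw [← Nat.not_even_iff_odd]
    rintro ⟨r, hr⟩
    simp only [Set.mem_ofPred_eq] at hr
    omega
  · exact fun x hx => hcore x hx

/-- Odd edges need an end of load `2k + 1`, so here every edge has weight two and a pendant end. The
component is a star, whose centre has even load at most `2k + 1` and hence degree at most `k`. -/
theorem isAllowed_of_not_full (hy : IsReduced k G y) (c : hy.support.ConnectedComponent)
    (hfull : ∀ v ∈ c.supp, load y v ≠ 2 * k + 1) : IsAllowedComponent k c c.toSimpleGraph := by
  classical
  have hmem : ∀ (v : c) {w : V}, hy.support.Adj v w → w ∈ c.supp := fun v w h =>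
    (ConnectedComponent.sound h.symm.reachable).trans v.2
  have heven : ∀ (v : c) w, Even (y s((v : V), w)) := by
    intro v w
    rw [← Int.not_odd_iff_even]
    intro ho
    have := hfull v v.2
    have := hfull w (hmem v (hy.adj_of_odd ho))
    rcases hy.odd_loads v w ho with h | h <;> omega
  have hadj : ∀ v : c, ∃ w : c, hy.support.Adj v w := by
    intro v
    have h1 := hy.weighting.lower v
    obtain ⟨w, -, hw⟩ := Finset.exists_ne_zero_of_sum_ne_zero
      (show ∑ w, y s((v : V), w) ≠ 0 by unfold load at h1; omega)
    have h2 := hy.weighting.nonneg s((v : V), w)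
    have h3 : hy.support.Adj v w := by
      change 0 < y s((v : V), w)
      omega
    exact ⟨⟨w, hmem v h3⟩, h3⟩
  -- The vertex `u` serves as the centre, `l` being pendant at it.
  obtain ⟨l, u, hl2, hl⟩ : ∃ l u : c, y s((l : V), u) = 2 ∧ load y l = 2 := by
    obtain ⟨v, hv⟩ := c.nonempty_supp
    obtain ⟨w, hw⟩ := hadj ⟨v, hv⟩
    obtain ⟨h1, h2 | h2⟩ := hy.even_edge _ _ hw (heven _ _)
    · exact ⟨_, _, h1, h2⟩
    · rw [Sym2.eq_swap] at h1
      exact ⟨_, ⟨v, hv⟩, h1, h2⟩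
  have hlu := hy.adj_iff_of_two hl2 hl
  have hdeg : load y u = 2 * ((c.toSimpleGraph.neighborSet u).ncard : ℤ) := by
    rw [← Set.ncard_image_of_injective _ Subtype.val_injective]
    have h1 : (Subtype.val '' c.toSimpleGraph.neighborSet u) = {w | hy.support.Adj u w} := by
      ext w
      constructor
      · rintro ⟨w, hw, rfl⟩
        exact hw
      · intro hw
        exact ⟨⟨w, hmem u hw⟩, hw, rfl⟩
    rw [h1, Set.ncard_eq_toFinset_card', Set.toFinset_ofPred, ← Finset.sum_boole, Finset.mul_sum]
    refine Finset.sum_congr rfl fun w _ => ?_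
    by_cases h : hy.support.Adj u w
    · simp [h, (hy.even_edge u w h (heven u w)).1]
    · have h2 : ¬ 0 < y s((u : V), w) := h
      have h3 := hy.weighting.nonneg s((u : V), w)
      simp only [h, if_false]
      omega
  have hlow := hy.weighting.lower u
  have hupp := hy.weighting.upper u
  refine isAllowedComponent_of_star c.connected_toSimpleGraph u ?_ (by omega) (by omega)
  intro w hw z hz
  have hw' : hy.support.Adj u w := hw
  have hz' : hy.support.Adj w z := hz
  obtain ⟨h1, h2 | h2⟩ := hy.even_edge u w hw' (heven u w)
  · have h3 : (l : V) = w := (hy.adj_iff_of_two h1 h2 l).1 ((hlu u).2 rfl).symm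
    rw [← h3] at hz'
    exact Subtype.ext ((hlu z).1 hz')
  · rw [Sym2.eq_swap] at h1
    exact Subtype.ext ((hy.adj_iff_of_two h1 h2 z).1 hz')

end IsReduced

theorem IsoBound.hasStarTreeFactor (hk : 2 ≤ k) (hG : IsoBound k G) : HasStarTreeFactor k G := by
  obtain ⟨y, hy⟩ := IsWeighting.exists_isReduced hk (hG.exists_weighting (by omega))
  refine ⟨hy.support, hy.support_le, fun c => ?_⟩
  by_cases h : ∃ x ∈ c.supp, load y x = 2 * k + 1
  · obtain ⟨x, hx, hfull⟩ := h
    exact hy.isAllowed_of_full hk c hx hfull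
  · push Not at h
    exact hy.isAllowed_of_not_full c h

end Reduced

/-! ### Too many edges for the criterion to fail -/

section EdgeCount

theorem halfFloor_eq (k t : ℕ) : halfFloor k t = (2 * k + 1) * t / 2 := by
  unfold halfFloor
  rw [← Nat.floor_div_eq_div (K := ℚ)]
  congr 1
  push_cast
  ring

/-- The step from `t` to `t + 1`. In the first alternative the conclusion is a rearrangement of the
hypothesis on the order `j + g + m`, which explains the form of that bound; in the second there is
slack. -/
theorem gap_of_add_one {k t j g m : ℤ} (hk : 0 < k) (ht : 0 ≤ t)
    (hn : (2 * k ^ 2 + 5 * k + 1) * t + k ^ 2 + 5 * k + 2 ≤ 2 * k * (j + g + m))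
    (h : (g = k ∧ 2 * j = 2 * (k * t) + t + 2) ∨ (g = k + 1 ∧ 2 * j = 2 * (k * t) + t + 1)) :
    2 * j ≤ g * (2 * m + g - 1 - 2 * (t + 1)) := by
  set E := 2 * m + g - 1 - 2 * (t + 1) with hE
  rcases h with ⟨rfl, hj⟩ | ⟨rfl, hj⟩
  · have h1 : g * (2 * j) = g * (2 * (g * t) + t + 2) := by rw [hj]
    rw [hE, hj]
    linarith
  · have h1 : k * (2 * j) = k * (2 * (k * t) + t + 1) := by rw [hj]
    have hkE : 2 * (k * t) + t + 2 ≤ k * E := by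
      rw [hE]
      linarith
    have hkt : 0 ≤ k * t := mul_nonneg hk.le ht
    have hEpos : 0 < E := pos_of_mul_pos_right (by linarith) hk.le
    rw [hj]
    linarith

/-- For larger steps `t < k` suffices: it gives `2j ≤ k(kd + 1)`, while both factors on the right
are large, the second being at least `kd`. -/
theorem gap_of_add_two_le {k t d j g m : ℤ} (hk : 1 ≤ k) (htk : t + 1 ≤ k) (hd : 2 ≤ d)
    (hg : k * d + 1 ≤ g) (hj : 2 * j ≤ 2 * (k * t) + t + 2) (hm : t + d ≤ m) :
    2 * d * j ≤ g * (2 * m + g - 1 - 2 * (t + d)) := by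
  have hkt : k * t ≤ k * (k - 1) := mul_le_mul_of_nonneg_left (by omega) (by omega)
  have hkd : k * (k * 2) ≤ k * (k * d) :=
    mul_le_mul_of_nonneg_left (mul_le_mul_of_nonneg_left hd (by omega)) (by omega)
  have hkd0 : 0 ≤ k * d := mul_nonneg (by omega) (by omega)
  calc 2 * d * j = d * (2 * j) := by ring
    _ ≤ d * (k * (k * d + 1)) := mul_le_mul_of_nonneg_left (by linarith) (by omega)
    _ = (k * d + 1) * (k * d) := by ring
    _ ≤ g * (k * d) := mul_le_mul_of_nonneg_right hg hkd0
    _ ≤ g * (2 * m + g - 1 - 2 * (t + d)) := mul_le_mul_of_nonneg_left (by omega) (by omega)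

theorem two_mul_choose_two (m : ℕ) : 2 * (m.choose 2 : ℤ) = m * (m - 1) := by
  rcases Nat.eq_zero_or_pos m with rfl | hm
  · simp
  · have h1 : 2 * m.choose 2 = m * (m - 1) := by
      rw [Nat.choose_two_right]
      exact Nat.two_mul_div_two_of_even (Nat.even_mul_pred_self m)
    have h2 : ((m - 1 : ℕ) : ℤ) = m - 1 := by omega
    rw [← h2]
    exact_mod_cast h1

theorem edge_bound_monotone {k t n s : ℕ} (hk : 2 ≤ k) (htk : t + 1 ≤ k)
    (hn : (2 * k ^ 2 + 5 * k + 1) * t + k ^ 2 + 5 * k + 2 ≤ 2 * k * n) (hts : t ≤ s)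
    (hsn : s + ((2 * k + 1) * s / 2 + 1) ≤ n) :
    (n - ((2 * k + 1) * s / 2 + 1)).choose 2 + s * ((2 * k + 1) * s / 2 + 1) ≤
      (n - ((2 * k + 1) * t / 2 + 1)).choose 2 + t * ((2 * k + 1) * t / 2 + 1) := by
  obtain ⟨d, rfl⟩ := Nat.exists_eq_add_of_le hts
  rcases Nat.eq_zero_or_pos d with rfl | hd
  · simp
  set i := (2 * k + 1) * (t + d) / 2 + 1 with hi
  set j := (2 * k + 1) * t / 2 + 1 with hj
  have hexp : (2 * k + 1) * (t + d) = (2 * k + 1) * t + (2 * k * d + d) := by ring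
  rw [hexp] at hi
  set P := (2 * k + 1) * t with hP
  have hjb : 2 * j = P + 2 - P % 2 := by omega
  have hij : j ≤ i := by omega
  obtain ⟨g, hg⟩ := Nat.exists_eq_add_of_le hij
  obtain ⟨m, hm⟩ := Nat.exists_eq_add_of_le (show i ≤ n by omega)
  have hgd : 2 * (k * d) + d ≤ 2 * g + 1 := by
    have : 2 * k * d = 2 * (k * d) := by ring
    omega
  have hmj : n - j = m + g := by omega
  have hmi : n - i = m := by omega
  have hmtd : t + d ≤ m := by omega
  have hPz : (P : ℤ) = 2 * (k * t) + t := by rw [hP]; push_cast; ring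
  -- Twice the difference of the two edge bounds, with `j` and `j + g` isolated vertices and `m` the
  -- number of vertices outside the larger isolated set.
  have key : 2 * (d : ℤ) * j ≤ g * (2 * m + g - 1 - 2 * (t + d)) := by
    rcases Nat.lt_or_ge d 2 with h1 | h2
    · obtain rfl : d = 1 := by omega
      have hn' : (2 * (k : ℤ) ^ 2 + 5 * k + 1) * t + k ^ 2 + 5 * k + 2 ≤ 2 * k * (j + g + m) := by
        have : n = j + g + m := by omega
        rw [this] at hn
        exact_mod_cast hn
      have h := gap_of_add_one (by omega) (by omega) hn' (g := g) (j := j)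
      rw [Nat.cast_one, mul_one]
      refine h ?_
      rcases Nat.mod_two_eq_zero_or_one P with h | h
      · exact Or.inl ⟨by omega, by omega⟩
      · exact Or.inr ⟨by omega, by omega⟩
    · refine gap_of_add_two_le (k := k) (by omega) (by omega) (by omega) ?_ (by omega) (by omega)
      have : k * d + 1 ≤ g := by omega
      exact_mod_cast this
  rw [hmj, hmi, hg]
  have hc1 := two_mul_choose_two m
  have hc2 := two_mul_choose_two (m + g)
  push_cast at hc2
  zify
  linarith

variable {V : Type u} [Fintype V] {G : SimpleGraph V}

/-- An edge either avoids `B` or joins `B` to `S`. -/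
theorem ncard_edgeSet_le {S B : Finset V} (hB : ∀ v ∈ B, ∀ w, G.Adj v w → w ∈ S) :
    G.edgeSet.ncard ≤ (Fintype.card V - B.card).choose 2 + S.card * B.card := by
  classical
  have hsub : G.edgeSet ⊆ ↑(Bᶜ.offDiag.image Sym2.mk.uncurry ∪
      (S ×ˢ B).image Sym2.mk.uncurry) := by
    intro e he
    induction e with | _ p q =>
      have hadj : G.Adj p q := he
      simp only [Finset.coe_union, Finset.coe_image, Set.mem_union, Set.mem_image,
        Finset.mem_coe, Finset.mem_offDiag, Finset.mem_compl, Finset.mem_product, Prod.exists,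
        Function.uncurry_apply_pair]
      by_cases hp : p ∈ B
      · exact Or.inr ⟨q, p, ⟨hB p hp q hadj, hp⟩, Sym2.eq_swap⟩
      · by_cases hq : q ∈ B
        · exact Or.inr ⟨p, q, ⟨hB q hq p hadj.symm, hq⟩, rfl⟩
        · exact Or.inl ⟨p, q, ⟨hp, hq, hadj.ne⟩, rfl⟩
  calc G.edgeSet.ncard ≤ _ := Set.ncard_le_ncard hsub (Finset.finite_toSet _)
    _ ≤ _ := by
      rw [Set.ncard_coe_finset]
      refine (Finset.card_union_le _ _).trans ?_
      rw [Sym2.card_image_offDiag, Finset.card_compl]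
      gcongr
      exact Finset.card_image_le.trans (Finset.card_product _ _).le

theorem isoBound_of_edgeBound_lt {k t n : ℕ} (hk : 2 ≤ k) (htk : t + 1 ≤ k)
    (hn : (2 * k ^ 2 + 5 * k + 1) * t + k ^ 2 + 5 * k + 2 ≤ 2 * k * n)
    (hcard : Fintype.card V = n) (hconn : IsTConnected G t)
    (hedge : edgeBound k t n < G.edgeSet.ncard) : IsoBound k G := by
  classical
  intro S B hdisj hB
  by_contra hcon
  rw [not_le] at hcon
  rcases Nat.lt_or_ge S.card t with hs | hs
  · have hc := hconn.2 S hs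
    obtain ⟨b, hb⟩ : B.Nonempty := by
      rw [← Finset.card_pos]
      omega
    have hbS : b ∉ S := Finset.disjoint_left.1 hdisj hb
    obtain ⟨v, hv⟩ : ∃ v, v ∉ insert b S := by
      by_contra hall
      push Not at hall
      have h1 := Finset.card_le_card (fun v _ => hall v : Finset.univ ⊆ insert b S)
      have h2 := Finset.card_insert_le b S
      have h3 := hconn.1
      rw [Finset.card_univ] at h1
      omega
    rw [Finset.mem_insert, not_or] at hv
    obtain ⟨p⟩ := hc.preconnected ⟨b, by simpa using hbS⟩ ⟨v, by simpa using hv.2⟩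
    cases p with
    | nil => exact hv.1 rfl
    | @cons _ w _ h p =>
      have hadj : G.Adj b w := h
      exact w.2 (hB b hb _ hadj)
  -- `B` is cut down to the least size that still violates the criterion, so the edge bound depends
  -- on `|S|` alone.
  · obtain ⟨B', hB'B, hB'card⟩ := Finset.exists_subset_card_eq
      (show (2 * k + 1) * S.card / 2 + 1 ≤ B.card by omega)
    have h1 := ncard_edgeSet_le (G := G) (S := S) (B := B') fun v hv => hB v (hB'B hv)
    have h2 : S.card + B'.card ≤ n := by
      rw [← hcard, ← Finset.card_union_of_disjoint
        ((Finset.disjoint_of_subset_left hB'B hdisj).symm)]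
      exact Finset.card_le_univ _
    rw [hB'card] at h1 h2
    rw [hcard] at h1
    have h3 := edge_bound_monotone hk htk hn hs h2
    unfold edgeBound at hedge
    rw [halfFloor_eq, Nat.sub_sub] at hedge
    omega

end EdgeCount

/-! ### A factor implies the criterion -/

section Necessity

/-- Double counting: all the weight at `B`, at least `2|B|`, goes to `S`, which can take at most
`(2k + 1)|S|`. -/
theorem isoBound_of_weight {W : Type u} [Fintype W] {k : ℕ} {F : SimpleGraph W} (w : W → W → ℕ)
    (hsymm : ∀ a b, w a b = w b a) (hadj : ∀ a b, w a b ≠ 0 → F.Adj a b)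
    (hlow : ∀ a, 2 ≤ ∑ b, w a b) (hupp : ∀ a, ∑ b, w a b ≤ 2 * k + 1) : IsoBound k F := by
  intro S B _ hB
  calc 2 * B.card = ∑ _b ∈ B, 2 := by simp [mul_comm]
    _ ≤ ∑ b ∈ B, ∑ s, w b s := Finset.sum_le_sum fun b _ => hlow b
    _ = ∑ b ∈ B, ∑ s ∈ S, w b s := by
      refine Finset.sum_congr rfl fun b hb => (Finset.sum_subset (Finset.subset_univ S) ?_).symm
      intro s _ hs
      by_contra hne
      exact hs (hB b hb s (hadj b s hne))
    _ = ∑ s ∈ S, ∑ b ∈ B, w s b := by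
      rw [Finset.sum_comm]
      simp only [hsymm]
    _ ≤ ∑ s ∈ S, ∑ b, w s b := Finset.sum_le_sum fun s _ =>
      Finset.sum_le_sum_of_subset (Finset.subset_univ B)
    _ ≤ ∑ _s ∈ S, (2 * k + 1) := Finset.sum_le_sum fun s _ => hupp s
    _ = (2 * k + 1) * S.card := by simp [mul_comm]

theorem IsoBound.of_iso {W : Type u} {W' : Type v} {k : ℕ} {F : SimpleGraph W}
    {F' : SimpleGraph W'} (e : F ≃g F') (h : IsoBound k F') : IsoBound k F := by
  intro S B hdisj hB
  have := h (S.map e.toEquiv.toEmbedding) (B.map e.toEquiv.toEmbedding)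
    ((Finset.disjoint_map _).2 hdisj) (by
      intro v hv w hw
      obtain ⟨b, hb, rfl⟩ := Finset.mem_map.1 hv
      obtain ⟨z, rfl⟩ := e.surjective w
      have hbz : F.Adj b z := e.map_adj_iff.1 hw
      exact Finset.mem_map_of_mem _ (hB b hb z hbz))
  simpa using this

theorem IsoBound.mono {V : Type u} {k : ℕ} {H G : SimpleGraph V} (hle : H ≤ G)
    (hH : IsoBound k H) : IsoBound k G :=
  fun S B hdisj hB => hH S B hdisj fun v hv w hw => hB v hv w (hle hw)

theorem isoBound_of_components {V : Type u} [Finite V] {k : ℕ} {H : SimpleGraph V}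
    (hH : ∀ c : H.ConnectedComponent, IsoBound k c.toSimpleGraph) : IsoBound k H := by
  classical
  have := Fintype.ofFinite V
  have := Fintype.ofFinite H.ConnectedComponent
  intro S B hdisj hB
  have hcard : ∀ A : Finset V, A.card =
      ∑ c : H.ConnectedComponent, (A.subtype (· ∈ c.supp)).card := by
    intro A
    rw [Finset.card_eq_sum_card_fiberwise (f := H.connectedComponentMk) (t := Finset.univ)
      (by simp)]
    refine Finset.sum_congr rfl fun c _ => ?_
    rw [Finset.card_subtype]
    exact congrArg Finset.card (Finset.filter_congr fun v _ => Iff.rfl)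
  rw [hcard S, hcard B, Finset.mul_sum, Finset.mul_sum]
  refine Finset.sum_le_sum fun c _ => hH c _ _ ?_ ?_
  · rw [Finset.disjoint_left] at hdisj ⊢
    intro v hv hv'
    rw [Finset.mem_subtype] at hv hv'
    exact hdisj hv hv'
  · intro v hv w hw
    rw [Finset.mem_subtype] at hv ⊢
    exact hB v hv w hw

theorem isoBound_star {j k : ℕ} (h1 : 1 ≤ j) (hj : j ≤ k) :
    IsoBound k (completeBipartiteGraph (Fin 1) (Fin j)) := by
  classical
  refine isoBound_of_weight
    (fun a b => if (completeBipartiteGraph (Fin 1) (Fin j)).Adj a b then 2 else 0)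
    (fun a b => by simp only [adj_comm]) (fun a b h => by_contra fun hn => h (if_neg hn)) ?_ ?_
  · rintro (a | a) <;> simp
    omega
  · rintro (a | a) <;> simp <;> omega

variable {V : Type u} {k : ℕ} {R : SimpleGraph V}

/-- The vertices of `T_R` as a sum type. -/
def treeVertEquiv (k : ℕ) (R : SimpleGraph V) :
    TreeVert k R ≃ V ⊕ ((core R).edgeSet ⊕
      (Σ x : CoreVert R, Fin (k - coreDegree R x / 2 - leafCount R x))) where
  toFun
    | .old x => .inl x
    | .mid e => .inr (.inl e)
    | .pendant x i => .inr (.inr ⟨x, i⟩)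
  invFun
    | .inl x => .old x
    | .inr (.inl e) => .mid e
    | .inr (.inr ⟨x, i⟩) => .pendant x i
  left_inv := by rintro (_ | _ | _) <;> rfl
  right_inv := by rintro (_ | _ | _) <;> rfl

open Classical in
/-- Edges of `T_R` at subdivision vertices get weight one, all other edges weight two. -/
noncomputable def treeWeight (k : ℕ) (R : SimpleGraph V) : TreeVert k R → TreeVert k R → ℕ
  | .old x, .old y => if R.Adj x y ∧ (x ∈ leafSet R ∨ y ∈ leafSet R) then 2 else 0
  | .old x, .mid e => if ∃ y : CoreVert R, (y : V) = x ∧ y ∈ (e : Sym2 (CoreVert R)) then 1 else 0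
  | .mid e, .old x => if ∃ y : CoreVert R, (y : V) = x ∧ y ∈ (e : Sym2 (CoreVert R)) then 1 else 0
  | .old x, .pendant y _ => if (y : V) = x then 2 else 0
  | .pendant y _, .old x => if (y : V) = x then 2 else 0
  | _, _ => 0

theorem treeWeight_comm (a b : TreeVert k R) : treeWeight k R a b = treeWeight k R b a := by
  rcases a with a | a | ⟨a, i⟩ <;> rcases b with b | b | ⟨b, j⟩ <;> try rfl
  have h : (R.Adj a b ∧ (a ∈ leafSet R ∨ b ∈ leafSet R)) ↔
      (R.Adj b a ∧ (b ∈ leafSet R ∨ a ∈ leafSet R)) := and_congr (R.adj_comm a b) or_comm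
  rw [treeWeight, treeWeight]
  split_ifs with h1 h2 h2
  · rfl
  · exact absurd (h.1 h1) h2
  · exact absurd (h.2 h2) h1
  · rfl

theorem adj_of_treeWeight_ne_zero (a b : TreeVert k R) (h : treeWeight k R a b ≠ 0) :
    (treeOf k R).Adj a b := by
  rw [treeOf, fromRel_adj]
  rcases a with a | a | ⟨a, i⟩ <;> rcases b with b | b | ⟨b, j⟩ <;>
    simp only [treeWeight, ne_eq, ite_eq_right_iff, not_forall, not_true_eq_false] at h
  · obtain ⟨h, -⟩ := h
    exact ⟨fun e => h.1.ne (by simpa using e), Or.inl h⟩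
  · exact ⟨by simp, Or.inl h.1⟩
  · exact ⟨by simp, Or.inl h.1⟩
  · exact ⟨by simp, Or.inr h.1⟩
  · exact ⟨by simp, Or.inr h.1⟩

section Sums

variable [Fintype V]

theorem sum_treeVert [Fintype (TreeVert k R)] [Fintype (core R).edgeSet] [Fintype (CoreVert R)]
    (f : TreeVert k R → ℕ) :
    ∑ t, f t = ∑ x, f (.old x) + (∑ e, f (.mid e) + ∑ x, ∑ i, f (.pendant x i)) := by
  rw [← (treeVertEquiv k R).symm.sum_comp, Fintype.sum_sum_type, Fintype.sum_sum_type,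
    Fintype.sum_sigma]
  rfl

theorem sum_treeWeight_leaf [Fintype (TreeVert k R)] {x : V} (hx : x ∈ leafSet R) :
    ∑ t, treeWeight k R (.old x) t = 2 := by
  classical
  rw [sum_treeVert]
  have h1 : ∑ y, treeWeight k R (.old x) (.old y) = 2 := by
    have h : (R.neighborSet x).ncard = 1 := hx
    rw [Set.ncard_eq_toFinset_card'] at h
    simp only [treeWeight, hx, true_or, and_true, ← Finset.sum_filter, Finset.sum_const,
      smul_eq_mul]
    rw [show (Finset.univ.filter fun y => R.Adj x y) = (R.neighborSet x).toFinset by ext; simp, h]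
  have h2 : ∀ e, treeWeight k R (.old x) (.mid e) = 0 := by
    intro e
    simp only [treeWeight, ite_eq_right_iff]
    rintro ⟨y, rfl, -⟩
    exact absurd hx y.2
  have h3 : ∀ y i, treeWeight k R (.old x) (.pendant y i) = 0 := by
    intro y i
    simp only [treeWeight, ite_eq_right_iff]
    rintro rfl
    exact absurd hx y.2
  simp [h1, h2, h3]

theorem sum_treeWeight_core [Fintype (TreeVert k R)] (x : CoreVert R) :
    ∑ t, treeWeight k R (.old x) t =
      2 * leafCount R x + (coreDegree R x + 2 * (k - coreDegree R x / 2 - leafCount R x)) := by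
  classical
  rw [sum_treeVert]
  congr 1
  · have hx : (x : V) ∉ leafSet R := x.2
    simp only [treeWeight, hx, false_or, ← Finset.sum_filter, Finset.sum_const, smul_eq_mul]
    rw [mul_comm, leafCount, Set.ncard_eq_toFinset_card']
    congr 2
    ext
    simp
  · congr 1
    · have h : ∀ e : (core R).edgeSet, (∃ y : CoreVert R, (y : V) = x ∧ y ∈ (e : Sym2 _)) ↔
          x ∈ (e : Sym2 (CoreVert R)) := by
        intro e
        constructor
        · rintro ⟨y, hy, hye⟩
          rwa [← Subtype.ext hy]
        · exact fun h => ⟨x, rfl, h⟩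
      simp only [treeWeight, h, Finset.sum_boole, Nat.cast_id]
      rw [coreDegree, Set.ncard_eq_toFinset_card', Set.toFinset_card, card_neighborSet_eq_degree,
        ← card_incidenceSet_eq_degree, ← Set.toFinset_card,
        ← Finset.card_map (Function.Embedding.subtype _)]
      congr 1
      ext e
      rw [Set.mem_toFinset]
      simp [incidenceSet, and_comm]
    · rw [Finset.sum_eq_single x]
      · simp [treeWeight, mul_comm]
      · intro y _ hy
        have : (y : V) ≠ x := fun h => hy (Subtype.ext h)
        simp [treeWeight, this]
      · simp

theorem sum_treeWeight_mid [Fintype (TreeVert k R)] (e : (core R).edgeSet) :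
    ∑ t, treeWeight k R (.mid e) t = 2 := by
  classical
  rw [sum_treeVert]
  obtain ⟨a, b, hab⟩ : ∃ a b, (e : Sym2 (CoreVert R)) = s(a, b) := by
    obtain ⟨e, he⟩ := e
    induction e with | _ a b => exact ⟨a, b, rfl⟩
  have hadj : (core R).Adj a b := by
    have := e.2
    rwa [hab] at this
  have h : (Finset.univ.filter fun x : V =>
      ∃ y : CoreVert R, (y : V) = x ∧ y ∈ (e : Sym2 (CoreVert R))) = {(a : V), (b : V)} := by
    ext x
    simp only [hab, Finset.mem_filter, Finset.mem_univ, true_and, Finset.mem_insert,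
      Finset.mem_singleton, Sym2.mem_iff]
    constructor
    · rintro ⟨y, rfl, rfl | rfl⟩ <;> simp
    · rintro (rfl | rfl)
      · exact ⟨a, rfl, Or.inl rfl⟩
      · exact ⟨b, rfl, Or.inr rfl⟩
  have hold : ∀ x, treeWeight k R (.mid e) (.old x) =
      if x ∈ ({(a : V), (b : V)} : Finset V) then 1 else 0 := by
    intro x
    have hx : (∃ y : CoreVert R, (y : V) = x ∧ y ∈ (e : Sym2 (CoreVert R))) ↔
        x ∈ ({(a : V), (b : V)} : Finset V) := by
      rw [← h, Finset.mem_filter]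
      exact (and_iff_right (Finset.mem_univ x)).symm
    simp only [treeWeight, hx]
  have hne : (a : V) ≠ b := fun e => hadj.ne (Subtype.ext e)
  simp only [hold, Finset.sum_ite_mem, Finset.univ_inter, Finset.sum_pair hne]
  simp [treeWeight]

theorem sum_treeWeight_pendant [Fintype (TreeVert k R)] (x : CoreVert R)
    (i : Fin (k - coreDegree R x / 2 - leafCount R x)) :
    ∑ t, treeWeight k R (.pendant x i) t = 2 := by
  classical
  rw [sum_treeVert]
  simp [treeWeight]

end Sums

/-- Under `treeWeight` leaves, subdivision vertices and pendant vertices have load `2`; at a core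
vertex the added pendant edges bring the load to exactly `2k + 1`, the core degree being odd. -/
theorem isoBound_treeOf [Finite V] (hk : 1 ≤ k) (hR : IsBaseTree k R) :
    IsoBound k (treeOf k R) := by
  classical
  have := Fintype.ofFinite V
  have : Fintype (TreeVert k R) := Fintype.ofEquiv _ (treeVertEquiv k R).symm
  have hsum : ∀ a, 2 ≤ ∑ b, treeWeight k R a b ∧ ∑ b, treeWeight k R a b ≤ 2 * k + 1 := by
    rintro (x | e | ⟨x, i⟩)
    · by_cases hx : x ∈ leafSet R
      · rw [sum_treeWeight_leaf hx]
        omega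
      · have h := sum_treeWeight_core (k := k) (⟨x, hx⟩ : CoreVert R)
        obtain ⟨⟨⟨r, hr⟩, h2⟩, h3⟩ := hR.2 ⟨x, hx⟩
        rw [h]
        omega
    · rw [sum_treeWeight_mid]
      omega
    · rw [sum_treeWeight_pendant]
      omega
  exact isoBound_of_weight (treeWeight k R) treeWeight_comm adj_of_treeWeight_ne_zero
    (fun a => (hsum a).1) (fun a => (hsum a).2)

theorem HasStarTreeFactor.isoBound [Finite V] {G : SimpleGraph V} (hk : 1 ≤ k)
    (hG : HasStarTreeFactor k G) : IsoBound k G := by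
  obtain ⟨H, hle, hH⟩ := hG
  refine IsoBound.mono hle (isoBound_of_components fun c => ?_)
  rcases hH c with ⟨j, h1, hj, ⟨e⟩⟩ | ⟨m, R, hR, ⟨e⟩⟩
  · exact (isoBound_star h1 hj).of_iso e
  · exact (isoBound_treeOf hk hR).of_iso e

end Necessity

/-! ### The extremal graph -/

section Extremal

theorem floor_add_three_halves (k t : ℕ) :
    ⌊((k : ℚ) + 3 / 2) * t⌋₊ = halfFloor k t + t := by
  rw [halfFloor, ← Nat.floor_add_natCast (by positivity)]
  congr 1
  ring

/-- The join of `K_t` with `K_a ∪ b K_1`. -/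
abbrev splitJoin (t a b : ℕ) : SimpleGraph (Fin t ⊕ (Fin a ⊕ Fin b)) := join ⊤ (⊤ ⊕g ⊥)

theorem splitJoin_isTConnected {t a b : ℕ} (hb : 0 < b) : IsTConnected (splitJoin t a b) t := by
  classical
  refine ⟨by simp; omega, fun S hS => ?_⟩
  obtain ⟨x, hx⟩ : ∃ x : Fin t, Sum.inl x ∉ S := by
    by_contra hall
    push Not at hall
    have h1 : (Finset.univ.map Function.Embedding.inl : Finset (Fin t ⊕ (Fin a ⊕ Fin b))) ⊆ S := by
      intro v hv
      obtain ⟨x, -, rfl⟩ := Finset.mem_map.1 hv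
      exact hall x
    have h2 := Finset.card_le_card h1
    simp at h2
    omega
  rw [connected_iff_exists_forall_reachable]
  refine ⟨⟨.inl x, by simpa using hx⟩, ?_⟩
  rintro ⟨v, hv⟩
  by_cases h : v = .inl x
  · subst h
    exact Reachable.refl _
  · refine Adj.reachable ?_
    rw [comap_adj]
    rcases v with y | y
    · have : x ≠ y := fun e => h (by rw [e])
      simp [join, this]
    · simp [join]

theorem two_mul_ncard_edgeSet {V : Type u} [Fintype V] (G : SimpleGraph V) [DecidableRel G.Adj] :
    2 * (G.edgeSet.ncard : ℤ) = ∑ v, ∑ w, if G.Adj v w then 1 else 0 := by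
  classical
  have h := G.sum_degrees_eq_twice_card_edges
  rw [Set.ncard_eq_toFinset_card']
  have h2 : ∀ v, (∑ w, if G.Adj v w then (1 : ℤ) else 0) = G.degree v := by
    intro v
    rw [Finset.sum_boole, ← card_neighborFinset_eq_degree, neighborFinset_eq_filter]
  simp only [h2]
  exact_mod_cast h.symm

theorem splitJoin_ncard_edgeSet (t a b : ℕ) :
    (splitJoin t a b).edgeSet.ncard = (t + a).choose 2 + t * b := by
  classical
  have hne : ∀ (m : ℕ) (x : Fin m), (∑ y, if x ≠ y then (1 : ℤ) else 0) = m - 1 := by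
    intro m x
    have h := Finset.sum_add_distrib (s := Finset.univ)
      (f := fun y => if x ≠ y then (1 : ℤ) else 0) (g := fun y => if x = y then (1 : ℤ) else 0)
    have h2 : ∀ y, ((if x ≠ y then (1 : ℤ) else 0) + if x = y then 1 else 0) = 1 := by
      intro y
      by_cases hxy : x = y <;> simp [hxy]
    simp only [h2] at h
    simp only [Finset.sum_const, Finset.card_univ, Fintype.card_fin, Finset.sum_ite_eq,
      Finset.mem_univ, if_true, nsmul_eq_mul, mul_one] at h
    linarith
  have h := two_mul_ncard_edgeSet (splitJoin t a b)
  have h00 : ∀ x y : Fin t, (splitJoin t a b).Adj (.inl x) (.inl y) ↔ x ≠ y := by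
    simp [join]
  have h01 : ∀ (x : Fin t) y, (splitJoin t a b).Adj (.inl x) (.inr y) ↔ True := by
    simp [join]
  have h10 : ∀ x (y : Fin t), (splitJoin t a b).Adj (.inr x) (.inl y) ↔ True := by
    simp [join]
  have h11 : ∀ x y : Fin a, (splitJoin t a b).Adj (.inr (.inl x)) (.inr (.inl y)) ↔ x ≠ y := by
    simp [join]
  have h12 : ∀ (x : Fin a) (y : Fin b),
      (splitJoin t a b).Adj (.inr (.inl x)) (.inr (.inr y)) ↔ False := by
    simp [join]
  have h21 : ∀ (x : Fin b) (y : Fin a),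
      (splitJoin t a b).Adj (.inr (.inr x)) (.inr (.inl y)) ↔ False := by
    simp [join]
  have h22 : ∀ x y : Fin b, (splitJoin t a b).Adj (.inr (.inr x)) (.inr (.inr y)) ↔ False := by
    simp [join]
  simp only [Fintype.sum_sum_type, h00, h01, h10, h11, h12, h21, h22, hne, if_true, if_false,
    Finset.sum_const, Finset.card_univ, Fintype.card_fin, nsmul_eq_mul, mul_one, mul_zero,
    add_zero] at h
  have h2 := two_mul_choose_two (t + a)
  zify
  push_cast at h h2
  linarith

/-- Removing `K_t` isolates the `b` independent vertices. -/
theorem splitJoin_not_isoBound {t a b k : ℕ} (hb : (2 * k + 1) * t < 2 * b) :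
    ¬ IsoBound k (splitJoin t a b) := by
  intro h
  have h1 := h (Finset.univ.map Function.Embedding.inl)
    (Finset.univ.map (Function.Embedding.inr.trans Function.Embedding.inr)) (by
      rw [Finset.disjoint_left]
      intro v hv hv'
      obtain ⟨x, -, rfl⟩ := Finset.mem_map.1 hv
      obtain ⟨y, -, hy⟩ := Finset.mem_map.1 hv'
      simp at hy) (by
      intro v hv w hw
      obtain ⟨x, -, rfl⟩ := Finset.mem_map.1 hv
      rcases w with w | w | w
      · exact Finset.mem_map_of_mem _ (Finset.mem_univ w)
      · simp [join] at hw
      · simp [join] at hw)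
  simp only [Finset.card_map, Finset.card_univ, Fintype.card_fin] at h1
  omega

end Extremal

end ComponentFactor

theorem theorem1p3 (k t n : ℕ) (hk : 2 ≤ k) (ht : 1 ≤ t) (htk : t ≤ k - 1)
    (hn : ((2 * (k : ℚ) ^ 2 + 5 * k + 1) * t + (k : ℚ) ^ 2 + 5 * k + 2) / (2 * k) ≤ (n : ℚ)) :
    (∀ (V : Type*) [Fintype V] (G : SimpleGraph V), Fintype.card V = n →
        ComponentFactor.IsTConnected G t →
        ComponentFactor.edgeBound k t n < G.edgeSet.ncard →
        ComponentFactor.HasStarTreeFactor k G) ∧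
      (Fintype.card (Fin t ⊕ (Fin (n - ⌊((k : ℚ) + 3 / 2) * t⌋₊ - 1) ⊕
          Fin (ComponentFactor.halfFloor k t + 1))) = n ∧
        ComponentFactor.IsTConnected (ComponentFactor.extremalGraph k t n) t ∧
        (ComponentFactor.extremalGraph k t n).edgeSet.ncard = ComponentFactor.edgeBound k t n ∧
        ¬ ComponentFactor.HasStarTreeFactor k (ComponentFactor.extremalGraph k t n)) := by
  have hn' : (2 * k ^ 2 + 5 * k + 1) * t + k ^ 2 + 5 * k + 2 ≤ 2 * k * n := by
    have hk0 : (0 : ℚ) < 2 * k := by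
      have : (0 : ℚ) < k := by exact_mod_cast (by omega : 0 < k)
      linarith
    rw [div_le_iff₀ hk0, mul_comm (n : ℚ)] at hn
    exact_mod_cast hn
  have hhalf := ComponentFactor.halfFloor_eq k t
  -- This keeps the natural-number subtractions in the extremal graph and in the edge bound from
  -- truncating.
  have hsize : ComponentFactor.halfFloor k t + t + 1 ≤ n := by
    by_contra hcon
    have h1 : 2 * n ≤ (2 * k + 1) * t + 2 * t := by omega
    have h2 : k * (2 * n) ≤ k * ((2 * k + 1) * t + 2 * t) := Nat.mul_le_mul_left k h1
    have h3 : (0 : ℕ) ≤ k * t := Nat.zero_le _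
    nlinarith
  have hfloor := ComponentFactor.floor_add_three_halves k t
  refine ⟨fun V _ G hcard hconn hedge => ?_, ?_, ?_, ?_, ?_⟩
  · exact (ComponentFactor.isoBound_of_edgeBound_lt hk (by omega) hn' hcard hconn
      hedge).hasStarTreeFactor hk
  · simp only [Fintype.card_sum, Fintype.card_fin, hfloor]
    omega
  · exact ComponentFactor.splitJoin_isTConnected (by omega)
  · refine (ComponentFactor.splitJoin_ncard_edgeSet _ _ _).trans ?_
    rw [ComponentFactor.edgeBound, hfloor]
    congr 2
    omega
  · intro h
    exact ComponentFactor.splitJoin_not_isoBound (by omega) (h.isoBound (by omega))
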